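/- Let $0<\alpha<1$ and let $\gamma\in C^2((0,\infty))$ be real-valued. Put $$\omega_{0,1}=\liminf_{t\to0^+}\frac{\ln|\gamma(t)|}{\ln t},\quad \omega_{0,2}=\limsup_{t\to0^+}\frac{\ln|\gamma(t)|}{\ln t},\quad \omega_{\infty,1}=\liminf_{t\to\infty}\frac{\ln|\gamma(t)|}{\ln t}.$$ Assume that $\gamma$ is monotonic on $(0,\infty)$, that $\lim_{t\to0^+}\gamma(t)=\lim_{t\to0^+}\gamma'(t)=0$, that $\omega_{\infty,1}\ge\omega_{0,2}$ and $\omega_{0,1}>1$, and that there are positive constants $C_1^{(1)},C_1^{(2)},C_2^{(1)}$ such that for all $t>0$ $$C_1^{(1)}\le\left|\frac{t\gamma'(t)}{\gamma(t)}\right|\le C_2^{(1)},\qquad \left|\frac{t^2\gamma''(t)}{\gamma(t)}\right|\ge C_1^{(2)}.$$ Assume moreover that $\frac{\alpha}{1-\alpha}\ge\omega_{\infty,1}$. For functions $f,g:\mathbb{R}\to\mathbb{C}$ let $$H_{\alpha,\gamma}(f,g)(x)=\int_0^\infty f(x-t)\,g(x-\gamma(t))\,\frac{dt}{t^{1-\alpha}}.$$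 Let $\left(\frac1p,\frac1q,\frac1r\right)$ lie in the open convex hull (the interior in $\mathbb{R}^3$ of the convex hull) of the points $$A(\alpha,0,0),\quad B(1,0,1-\alpha),\quad C_1\left(0,\tfrac{\alpha}{\omega_{\infty,1}},0\right),\quad C_2\left(0,\tfrac{\alpha}{\omega_{0,2}},0\right),$$ $$D_1\left(0,1,1-\tfrac{\alpha}{\omega_{\infty,1}}\right),\quad D_2\left(0,1,1-\tfrac{\alpha}{\omega_{0,2}}\right),\quad H\left(\tfrac{\omega_{\infty,1}-\alpha}{\omega_{\infty,1}},1,\tfrac{2(\omega_{\infty,1}-\alpha)}{\omega_{\infty,1}}\right),$$ together with $G_1\left(1,\frac{1-\alpha}{2-\omega_{\infty,1}},\frac{2(1-\alpha)}{2-\omega_{\infty,1}}\right)$ if $\omega_{\infty,1}\le2\alpha$, and with $G_2^1\left(1,\frac{\alpha}{\omega_{\infty,1}},1\right)$ and $G_2^2\left(1,\frac12,1\right)$ if $2\alpha<\omega_{\infty,1}$. Then there is a constant $C>0$ such that for all $f\in L^p(\mathbb{R})$ and $g\in L^q(\mathbb{R})$ the integral defining $H_{\alpha,\gamma}(f,g)(x)$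 converges absolutely for almost every $x$, $H_{\alpha,\gamma}(f,g)\in L^r(\mathbb{R})$, and $$\|H_{\alpha,\gamma}(f,g)\|_{L^r(\mathbb{R})}\le C\,\|f\|_{L^p(\mathbb{R})}\,\|g\|_{L^q(\mathbb{R})}.$$ -/

import Mathlib

open MeasureTheory Filter Topology Set

noncomputable section

namespace BilinearFractional

/-- The lower order of growth `liminf_{t → 0⁺} ln |γ(t)| / ln t`. -/
def omegaZero₁ (γ : ℝ → ℝ) : ℝ :=
  liminf (fun t : ℝ => Real.log |γ t| / Real.log t) (𝓝[>] 0)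

/-- The upper order of growth `limsup_{t → 0⁺} ln |γ(t)| / ln t`. -/
def omegaZero₂ (γ : ℝ → ℝ) : ℝ :=
  limsup (fun t : ℝ => Real.log |γ t| / Real.log t) (𝓝[>] 0)

/-- The lower order of growth `liminf_{t → ∞} ln |γ(t)| / ln t`. -/
def omegaInfty₁ (γ : ℝ → ℝ) : ℝ :=
  liminf (fun t : ℝ => Real.log |γ t| / Real.log t) atTop

/-- Hypothesis (H.) on the curve `(t, γ(t))`, `t > 0`.  Only the values of `γ` on `(0, ∞)` matter.
The lower bound in `first_deriv` forces `γ t ≠ 0` for `t > 0`; the two bounds together keep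
`ln |γ(t)| / ln t` bounded near `0` and near `∞`, so the real-valued `liminf` and `limsup` above are
the true ones. -/
structure CurveHypothesis (γ : ℝ → ℝ) : Prop where
  contDiffOn : ContDiffOn ℝ 2 γ (Ioi 0)
  monotonic : MonotoneOn γ (Ioi 0) ∨ AntitoneOn γ (Ioi 0)
  tendsto_zero : Tendsto γ (𝓝[>] 0) (𝓝 0)
  tendsto_deriv_zero : Tendsto (deriv γ) (𝓝[>] 0) (𝓝 0)
  omega_le : omegaZero₂ γ ≤ omegaInfty₁ γ
  one_lt_omega : 1 < omegaZero₁ γ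
  first_deriv : ∃ c > 0, ∃ C > 0, ∀ t > 0,
    c ≤ |t * deriv γ t / γ t| ∧ |t * deriv γ t / γ t| ≤ C
  second_deriv : ∃ c > 0, ∀ t > 0, c ≤ |t ^ 2 * iteratedDeriv 2 γ t / γ t|

/-- The integrand of `H_{α,γ}(f,g)(x)` as a function of `t`. -/
def integrand (α : ℝ) (γ : ℝ → ℝ) (f g : ℝ → ℂ) (x t : ℝ) : ℂ :=
  f (x - t) * g (x - γ t) / ((t ^ (1 - α) : ℝ) : ℂ)

/-- The bilinear fractional integral
`H_{α,γ}(f,g)(x) = ∫_0^∞ f(x - t) g(x - γ(t)) dt / t^{1-α}`. -/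
def bilinearFractional (α : ℝ) (γ : ℝ → ℝ) (f g : ℝ → ℂ) (x : ℝ) : ℂ :=
  ∫ t in Ioi (0 : ℝ), integrand α γ f g x t

/-- The points `A, B, C₁, C₂, D₁, D₂, H`. -/
def commonVertices (α : ℝ) (γ : ℝ → ℝ) : Set (ℝ × ℝ × ℝ) :=
  {(α, 0, 0),
   (1, 0, 1 - α),
   (0, α / omegaInfty₁ γ, 0),
   (0, α / omegaZero₂ γ, 0),
   (0, 1, 1 - α / omegaInfty₁ γ),
   (0, 1, 1 - α / omegaZero₂ γ),
   ((omegaInfty₁ γ - α) / omegaInfty₁ γ, 1, 2 * (omegaInfty₁ γ - α) / omegaInfty₁ γ)}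

/-- The point `G₁` if `ω_{∞,1} ≤ 2α`, the points `G₂¹, G₂²` if `2α < ω_{∞,1}`. -/
def extraVertices (α : ℝ) (γ : ℝ → ℝ) : Set (ℝ × ℝ × ℝ) :=
  if omegaInfty₁ γ ≤ 2 * α then
    {(1, (1 - α) / (2 - omegaInfty₁ γ), 2 * (1 - α) / (2 - omegaInfty₁ γ))}
  else
    {(1, α / omegaInfty₁ γ, 1), (1, 1 / 2, 1)}

/-- The open convex hull of all the points. -/
def region (α : ℝ) (γ : ℝ → ℝ) : Set (ℝ × ℝ × ℝ) :=
  interior (convexHull ℝ (commonVertices α γ ∪ extraVertices α γ))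

end BilinearFractional

end

/-! Taking absolute values reduces the theorem to the positive form `posForm` with the measure
t^{α-1} dt on (0,∞). This half-line is cut into countably many pieces. On a piece E of length ℓ with
|γ'| ≥ m and |γ' - 1| ≥ n, bounds at seven exponent triples (`vertex`) are elementary: Tonelli,
translation invariance, the substitutions s = γ(t) and s = γ(t) - t, and a localisation argument for
the target L^{1/2}. Because the form is positive, Hölder's inequality in t and then in x
interpolates between these bounds (`HasBound.interpolate`), also when r < 1. The pieces can be added
once their constants decay geometrically (`HasBound.sum`).

The rest is linear bookkeeping of exponents. Near 0 and near ∞ the pieces are dyadic. In between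
they are the sets where |γ' - 1| ~ 2^{-j} with a fixed sign; these are intervals of length
O(2^{-j}), because γ'' does not vanish. In each regime the bound at the i-th vertex is of size 2^{-j
e_i}, and `Attains` records the averaged exponent available at a point P. By convexity it suffices
to inspect the points spanning the region (`attains_of_mem_convexHull`): they attain the exponent
that balances the weight, up to an arbitrarily small loss, since |γ| ≥ t^b holds only for b slightly
different from the order of growth. An interior point P lies strictly between a point of the hull
and a vertex whose decay is strictly better (`exists_extrapolation`); this pays for the loss and
makes the geometric series converge. -/

open scoped ENNReal

noncomputable section

namespace BilinearFractional

/-! ### Positive bilinear forms: interpolation and summation. -/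

/-- The positive bilinear form `∫ F(x - t) G(x - γ(t)) dμ(t)`. -/
def posForm (γ : ℝ → ℝ) (μ : Measure ℝ) (F G : ℝ → ℝ≥0∞) (x : ℝ) : ℝ≥0∞ :=
  ∫⁻ t, F (x - t) * G (x - γ t) ∂μ

/-- The `L^{1/w}` (quasi-)norm of `h` is at most `K`; for `w = 0` this is a bound at every point. -/
def NormLE (w : ℝ) (h : ℝ → ℝ≥0∞) (K : ℝ≥0∞) : Prop :=
  (w = 0 ∧ ∀ x, h x ≤ K) ∨ (0 < w ∧ ∫⁻ x, h x ^ (1 / w) ≤ K ^ (1 / w))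

/-- `posForm γ μ` is bounded from `L^{1/u} × L^{1/v}` to `L^{1/w}` with constant `K`, where
`(u, v, w) = P`. The functions are written as powers of integrable ones. -/
def HasBound (γ : ℝ → ℝ) (μ : Measure ℝ) (P : ℝ × ℝ × ℝ) (K : ℝ≥0∞) : Prop :=
  ∀ F G : ℝ → ℝ≥0∞, Measurable F → Measurable G →
    NormLE P.2.2 (posForm γ μ (fun y => F y ^ P.1) (fun y => G y ^ P.2.1))
      (K * (∫⁻ y, F y) ^ P.1 * (∫⁻ y, G y) ^ P.2.1)

theorem measurable_posForm_integrand {γ : ℝ → ℝ} (hγ : Measurable γ) {F G : ℝ → ℝ≥0∞}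
    (hF : Measurable F) (hG : Measurable G) :
    Measurable fun z : ℝ × ℝ => F (z.1 - z.2) * G (z.1 - γ z.2) :=
  (hF.comp (measurable_fst.sub measurable_snd)).mul
    (hG.comp (measurable_fst.sub (hγ.comp measurable_snd)))

theorem measurable_posForm {γ : ℝ → ℝ} (hγ : Measurable γ) (μ : Measure ℝ) [SFinite μ]
    {F G : ℝ → ℝ≥0∞} (hF : Measurable F) (hG : Measurable G) :
    Measurable (posForm γ μ F G) :=
  (measurable_posForm_integrand hγ hF hG).lintegral_prod_right'

theorem ennreal_rpow_sum_of_nonneg {ι : Type*} (s : Finset ι) (x : ℝ≥0∞) (a : ι → ℝ)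
    (ha : ∀ i ∈ s, 0 ≤ a i) : x ^ ∑ i ∈ s, a i = ∏ i ∈ s, x ^ a i := by
  classical
  induction s using Finset.induction_on with
  | empty => simp
  | insert i s his ih =>
    rw [Finset.sum_insert his, Finset.prod_insert his, ENNReal.rpow_add_of_nonneg,
      ih fun j hj => ha j (Finset.mem_insert_of_mem hj)]
    · exact ha i (Finset.mem_insert_self _ _)
    · exact Finset.sum_nonneg fun j hj => ha j (Finset.mem_insert_of_mem hj)

/-- Hölder's inequality for a geometric mean of functions in different Lebesgue spaces. -/
theorem NormLE.prod_rpow {ι : Type*} [Fintype ι] {θ w : ι → ℝ} (hθ : ∀ i, 0 ≤ θ i)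
    {h : ι → ℝ → ℝ≥0∞} (hm : ∀ i, Measurable (h i)) {K : ι → ℝ≥0∞}
    (hK : ∀ i, NormLE (w i) (h i) (K i)) (hpos : 0 < ∑ i, θ i * w i) :
    ∫⁻ x, (∏ i, h i x ^ θ i) ^ (1 / ∑ i, θ i * w i) ≤
      (∏ i, K i ^ θ i) ^ (1 / ∑ i, θ i * w i) := by
  classical
  set W := ∑ i, θ i * w i with hW
  have hW' : 0 ≤ 1 / W := by positivity
  set A : Finset ι := Finset.univ.filter fun i => w i = 0 with hA
  set B : Finset ι := Finset.univ.filter fun i => ¬ w i = 0 with hB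
  -- Factors with `w i = 0` are bounded pointwise and leave the integral; the others are raised to
  -- `1 / w i`, and their Hölder exponents `θ i * w i / W` sum to 1.
  have hsplit : ∀ y : ι → ℝ≥0∞, (∏ i, y i ^ θ i) ^ (1 / W) =
      (∏ i ∈ A, y i ^ (θ i * (1 / W))) * ∏ i ∈ B, (y i ^ (1 / w i)) ^ (θ i * w i / W) := by
    intro y
    rw [← ENNReal.prod_rpow_of_nonneg hW',
      ← Finset.prod_filter_mul_prod_filter_not Finset.univ fun i => w i = 0]
    congr 1
    · refine Finset.prod_congr rfl fun i _ => ?_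
      rw [ENNReal.rpow_mul]
    · refine Finset.prod_congr rfl fun i hi => ?_
      have : w i ≠ 0 := (Finset.mem_filter.1 hi).2
      rw [← ENNReal.rpow_mul, ← ENNReal.rpow_mul]
      congr 1
      field_simp
  have hsumB : ∑ i ∈ B, θ i * w i / W = 1 := by
    rw [← Finset.sum_div, div_eq_one_iff_eq hpos.ne', hW,
      ← Finset.sum_filter_add_sum_filter_not Finset.univ fun i => w i = 0]
    rw [Finset.sum_eq_zero (s := Finset.univ.filter fun i => w i = 0), zero_add]
    intro i hi
    rw [(Finset.mem_filter.1 hi).2, mul_zero]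
  have hwB : ∀ i ∈ B, 0 < w i := by
    intro i hi
    rcases hK i with h0 | h0
    · exact absurd h0.1 (Finset.mem_filter.1 hi).2
    · exact h0.1
  calc ∫⁻ x, (∏ i, h i x ^ θ i) ^ (1 / W)
      ≤ ∫⁻ x, (∏ i ∈ A, K i ^ (θ i * (1 / W))) *
          ∏ i ∈ B, (h i x ^ (1 / w i)) ^ (θ i * w i / W) := by
        refine lintegral_mono fun x => ?_
        rw [hsplit fun i => h i x]
        refine mul_le_mul_left ?_ _
        refine Finset.prod_le_prod' fun i hi => ?_
        refine ENNReal.rpow_le_rpow ?_ (mul_nonneg (hθ i) hW')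
        rcases hK i with h0 | h0
        · exact h0.2 x
        · exact absurd (Finset.mem_filter.1 hi).2 h0.1.ne'
    _ = (∏ i ∈ A, K i ^ (θ i * (1 / W))) *
          ∫⁻ x, ∏ i ∈ B, (h i x ^ (1 / w i)) ^ (θ i * w i / W) := by
        refine lintegral_const_mul _ ?_
        exact Finset.measurable_prod _ fun i _ => ((hm i).pow_const _).pow_const _
    _ ≤ (∏ i ∈ A, K i ^ (θ i * (1 / W))) *
          ∏ i ∈ B, (∫⁻ x, h i x ^ (1 / w i)) ^ (θ i * w i / W) := by
        refine mul_le_mul_right ?_ _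
        refine ENNReal.lintegral_prod_norm_pow_le B
          (fun i _ => ((hm i).pow_const _).aemeasurable) hsumB fun i hi => ?_
        exact div_nonneg (mul_nonneg (hθ i) (hwB i hi).le) hpos.le
    _ ≤ (∏ i ∈ A, K i ^ (θ i * (1 / W))) *
          ∏ i ∈ B, (K i ^ (1 / w i)) ^ (θ i * w i / W) := by
        refine mul_le_mul_right ?_ _
        refine Finset.prod_le_prod' fun i hi => ?_
        refine ENNReal.rpow_le_rpow ?_ (div_nonneg (mul_nonneg (hθ i) (hwB i hi).le) hpos.le)
        rcases hK i with h0 | h0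
        · exact absurd h0.1 (Finset.mem_filter.1 hi).2
        · exact h0.2
    _ = (∏ i, K i ^ θ i) ^ (1 / W) := (hsplit K).symm

/-- Multilinear interpolation for positive forms, by two applications of Hölder's inequality. -/
theorem HasBound.interpolate {ι : Type*} [Fintype ι] {γ : ℝ → ℝ} (hγ : Measurable γ)
    {μ : Measure ℝ} [SFinite μ] {V : ι → ℝ × ℝ × ℝ} {K : ι → ℝ≥0∞}
    (hV : ∀ i, 0 ≤ (V i).1 ∧ 0 ≤ (V i).2.1)
    (hK : ∀ i, HasBound γ μ (V i) (K i)) {θ : ι → ℝ} (hθ : ∀ i, 0 ≤ θ i) (hsum : ∑ i, θ i = 1)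
    (hpos : 0 < ∑ i, θ i * (V i).2.2) :
    HasBound γ μ (∑ i, θ i * (V i).1, ∑ i, θ i * (V i).2.1, ∑ i, θ i * (V i).2.2)
      (∏ i, K i ^ θ i) := by
  intro F G hF hG
  refine Or.inr ⟨hpos, ?_⟩
  set T : ι → ℝ → ℝ≥0∞ :=
    fun i => posForm γ μ (fun y => F y ^ (V i).1) (fun y => G y ^ (V i).2.1) with hT
  have hTm : ∀ i, Measurable (T i) :=
    fun i => measurable_posForm hγ μ (hF.pow_const _) (hG.pow_const _)
  have hpow : ∀ (x : ℝ≥0∞) (a : ι → ℝ), (∀ i, 0 ≤ a i) →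
      x ^ ∑ i, θ i * a i = ∏ i, (x ^ a i) ^ θ i := by
    intro x a ha
    rw [ennreal_rpow_sum_of_nonneg _ _ _ fun i _ => mul_nonneg (hθ i) (ha i)]
    exact Finset.prod_congr rfl fun i _ => by rw [mul_comm, ENNReal.rpow_mul]
  have hprod : ∀ (a b : ι → ℝ≥0∞), (∏ i, a i ^ θ i) * ∏ i, b i ^ θ i = ∏ i, (a i * b i) ^ θ i := by
    intro a b
    rw [← Finset.prod_mul_distrib]
    exact Finset.prod_congr rfl fun i _ => (ENNReal.mul_rpow_of_nonneg _ _ (hθ i)).symm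
  -- Hölder in t, with the weights `θ`; the second application, in x, is `NormLE.prod_rpow`.
  have hpt : ∀ x, posForm γ μ (fun y => F y ^ ∑ i, θ i * (V i).1)
      (fun y => G y ^ ∑ i, θ i * (V i).2.1) x ≤ ∏ i, T i x ^ θ i := by
    intro x
    calc _ = ∫⁻ t, ∏ i, (F (x - t) ^ (V i).1 * G (x - γ t) ^ (V i).2.1) ^ θ i ∂μ := by
          refine lintegral_congr fun t => ?_
          simp only
          rw [hpow _ _ fun i => (hV i).1, hpow _ _ fun i => (hV i).2, hprod]
      _ ≤ _ := by
          refine ENNReal.lintegral_prod_norm_pow_le Finset.univ (fun i _ => ?_) hsum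
            fun i _ => hθ i
          exact ((measurable_posForm_integrand hγ (hF.pow_const (V i).1)
            (hG.pow_const (V i).2.1)).comp measurable_prodMk_left).aemeasurable
  refine (lintegral_mono fun x => ENNReal.rpow_le_rpow (hpt x) (by positivity)).trans ?_
  refine (NormLE.prod_rpow hθ hTm (fun i => hK i F G hF hG) hpos).trans (le_of_eq ?_)
  simp only
  rw [hpow _ _ fun i => (hV i).1, hpow _ _ fun i => (hV i).2, hprod, hprod]

theorem HasBound.mono_measure {γ : ℝ → ℝ} {μ ν : Measure ℝ} {P : ℝ × ℝ × ℝ} {K : ℝ≥0∞}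
    (h : HasBound γ ν P K) (hμν : μ ≤ ν) : HasBound γ μ P K := by
  intro F G hF hG
  have hT : ∀ x, posForm γ μ (fun y => F y ^ P.1) (fun y => G y ^ P.2.1) x ≤
      posForm γ ν (fun y => F y ^ P.1) (fun y => G y ^ P.2.1) x :=
    fun x => lintegral_mono' hμν le_rfl
  rcases h F G hF hG with h0 | h0
  · exact Or.inl ⟨h0.1, fun x => (hT x).trans (h0.2 x)⟩
  · refine Or.inr ⟨h0.1, (lintegral_mono fun x => ENNReal.rpow_le_rpow (hT x) ?_).trans h0.2⟩
    exact one_div_nonneg.2 h0.1.le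

theorem NormLE.mono {w : ℝ} {h : ℝ → ℝ≥0∞} {K K' : ℝ≥0∞} (hh : NormLE w h K) (hK : K ≤ K') :
    NormLE w h K' := by
  rcases hh with h0 | h0
  · exact Or.inl ⟨h0.1, fun x => (h0.2 x).trans hK⟩
  · exact Or.inr ⟨h0.1, h0.2.trans (ENNReal.rpow_le_rpow hK (one_div_nonneg.2 h0.1.le))⟩

theorem HasBound.mono {γ : ℝ → ℝ} {μ : Measure ℝ} {P : ℝ × ℝ × ℝ} {K K' : ℝ≥0∞}
    (h : HasBound γ μ P K) (hK : K ≤ K') : HasBound γ μ P K' :=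
  fun F G hF hG => (h F G hF hG).mono (by gcongr)

theorem HasBound.smul {γ : ℝ → ℝ} (hγ : Measurable γ) {μ : Measure ℝ} [SFinite μ] {P : ℝ × ℝ × ℝ}
    {K : ℝ≥0∞} (h : HasBound γ μ P K) (c : ℝ≥0∞) : HasBound γ (c • μ) P (c * K) := by
  intro F G hF hG
  have hT : ∀ x, posForm γ (c • μ) (fun y => F y ^ P.1) (fun y => G y ^ P.2.1) x =
      c * posForm γ μ (fun y => F y ^ P.1) (fun y => G y ^ P.2.1) x := by
    intro x
    simp only [posForm]
    rw [lintegral_smul_measure, smul_eq_mul]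
  rcases h F G hF hG with h0 | h0
  · refine Or.inl ⟨h0.1, fun x => ?_⟩
    rw [hT, mul_assoc, mul_assoc, ← mul_assoc K]
    exact mul_le_mul_right (h0.2 x) _
  · refine Or.inr ⟨h0.1, ?_⟩
    have hw : 0 ≤ 1 / P.2.2 := one_div_nonneg.2 h0.1.le
    simp only [hT, ENNReal.mul_rpow_of_nonneg _ _ hw] at *
    rw [lintegral_const_mul _
      ((measurable_posForm hγ μ (hF.pow_const _) (hG.pow_const _)).pow_const _),
      mul_assoc, mul_assoc, ← mul_assoc (K ^ _)]
    exact mul_le_mul_right h0.2 _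

/-- Countably many pieces with summable constants can be added, whatever the exponent `1/w > 0`. -/
theorem HasBound.sum {ι : Type*} [Countable ι] {γ : ℝ → ℝ} (hγ : Measurable γ) {μ : ι → Measure ℝ}
    [∀ i, SFinite (μ i)] {P : ℝ × ℝ × ℝ} (hP : 0 < P.2.2) {K : ι → ℝ≥0∞}
    (hK0 : ∀ i, K i ≠ 0) (hKtop : ∀ i, K i ≠ ∞)
    (hsum : ∀ τ : ℝ, 0 < τ → ∑' i, K i ^ τ ≠ ∞) (h : ∀ i, HasBound γ (μ i) P (K i)) :
    ∃ C : ℝ≥0∞, C ≠ ∞ ∧ HasBound γ (Measure.sum μ) P C := by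
  set r := 1 / P.2.2 with hr
  have hr0 : 0 < r := by positivity
  -- Half of each constant is spent on the sum and half on the norm: ∑ X_i ≤ (∑ ρ_i) sup_i ρ_i⁻¹
  -- X_i, and the supremum is at most the ℓ^r norm. No triangle inequality is used, so r < 1 is
  -- allowed.
  set ρ : ι → ℝ≥0∞ := fun i => K i ^ (1 / 2 : ℝ) with hρ
  have hρ0 : ∀ i, ρ i ≠ 0 := fun i => by simp [hρ, hK0 i, hKtop i]
  have hρtop : ∀ i, ρ i ≠ ∞ := fun i => by simp [hρ, hK0 i, hKtop i]
  have hρρ : ∀ i, (ρ i)⁻¹ * K i = K i ^ (1 / 2 : ℝ) := by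
    intro i
    have : K i = ρ i * ρ i := by
      simp only [hρ]
      rw [← ENNReal.rpow_add _ _ (hK0 i) (hKtop i)]
      norm_num
    conv_lhs => rw [this]
    rw [← mul_assoc, ENNReal.inv_mul_cancel (hρ0 i) (hρtop i), one_mul]
  set S : ℝ≥0∞ := ∑' i, (K i ^ (1 / 2 : ℝ)) ^ r with hS
  have hS_fin : S ≠ ∞ := by
    simp only [hS, ← ENNReal.rpow_mul]
    exact hsum _ (by positivity)
  refine ⟨(∑' i, ρ i) * S ^ (1 / r), ?_, ?_⟩
  · exact ENNReal.mul_ne_top (hsum _ (by norm_num))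
      (ENNReal.rpow_ne_top_of_nonneg (by positivity) hS_fin)
  intro F G hF hG
  refine Or.inr ⟨hP, ?_⟩
  set N : ℝ≥0∞ := (∫⁻ y, F y) ^ P.1 * (∫⁻ y, G y) ^ P.2.1 with hN
  set X : ι → ℝ → ℝ≥0∞ :=
    fun i => posForm γ (μ i) (fun y => F y ^ P.1) (fun y => G y ^ P.2.1) with hX
  have hXm : ∀ i, Measurable (X i) :=
    fun i => measurable_posForm hγ (μ i) (hF.pow_const _) (hG.pow_const _)
  have hXb : ∀ i, ∫⁻ x, X i x ^ r ≤ (K i * N) ^ r := by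
    intro i
    rcases h i F G hF hG with h0 | h0
    · exact absurd h0.1 hP.ne'
    · rw [hN, ← mul_assoc]
      exact h0.2
  have hpt : ∀ x, posForm γ (Measure.sum μ) (fun y => F y ^ P.1) (fun y => G y ^ P.2.1) x ^ r ≤
      (∑' i, ρ i) ^ r * ∑' i, ((ρ i)⁻¹ * X i x) ^ r := by
    intro x
    have h1 : posForm γ (Measure.sum μ) (fun y => F y ^ P.1) (fun y => G y ^ P.2.1) x ≤
        (∑' i, ρ i) * (∑' i, ((ρ i)⁻¹ * X i x) ^ r) ^ (1 / r) := by
      simp only [posForm]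
      rw [lintegral_sum_measure, ← ENNReal.tsum_mul_right]
      refine ENNReal.tsum_le_tsum fun i => ?_
      have h2 : (ρ i)⁻¹ * X i x ≤ (∑' i, ((ρ i)⁻¹ * X i x) ^ r) ^ (1 / r) := by
        rw [one_div, ENNReal.le_rpow_inv_iff hr0]
        exact ENNReal.le_tsum (f := fun i => ((ρ i)⁻¹ * X i x) ^ r) i
      calc _ = ρ i * ((ρ i)⁻¹ * X i x) := by
            rw [← mul_assoc, ENNReal.mul_inv_cancel (hρ0 i) (hρtop i), one_mul]
            rfl
        _ ≤ _ := mul_le_mul_right h2 _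
    refine (ENNReal.rpow_le_rpow h1 hr0.le).trans (le_of_eq ?_)
    rw [ENNReal.mul_rpow_of_nonneg _ _ hr0.le, ← ENNReal.rpow_mul, one_div_mul_cancel hr0.ne',
      ENNReal.rpow_one]
  refine (lintegral_mono hpt).trans ?_
  have hYm : ∀ i, Measurable fun x => ((ρ i)⁻¹ * X i x) ^ r :=
    fun i => ((hXm i).const_mul _).pow_const _
  rw [lintegral_const_mul _ (Measurable.tsum hYm),
    lintegral_tsum fun i => (hYm i).aemeasurable, mul_assoc, ← hN, mul_assoc,
    ENNReal.mul_rpow_of_nonneg _ _ hr0.le]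
  refine mul_le_mul_right ?_ _
  rw [ENNReal.mul_rpow_of_nonneg _ _ hr0.le, ← ENNReal.rpow_mul, one_div_mul_cancel hr0.ne',
    ENNReal.rpow_one, hS, ← ENNReal.tsum_mul_right]
  refine ENNReal.tsum_le_tsum fun i => ?_
  calc ∫⁻ x, ((ρ i)⁻¹ * X i x) ^ r = ((ρ i)⁻¹) ^ r * ∫⁻ x, X i x ^ r := by
        simp only [ENNReal.mul_rpow_of_nonneg _ _ hr0.le]
        rw [lintegral_const_mul _ ((hXm i).pow_const _)]
    _ ≤ ((ρ i)⁻¹) ^ r * (K i * N) ^ r := mul_le_mul_right (hXb i) _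
    _ = _ := by
        rw [← ENNReal.mul_rpow_of_nonneg _ _ hr0.le, ← mul_assoc, hρρ,
          ENNReal.mul_rpow_of_nonneg _ _ hr0.le]

/-! ### Endpoint estimates on a single piece. -/

/-- A set of parameters on which the curve has comparable geometry: `E` has length at most `ℓ`,
`E` and `γ(E)` have length at most `Λ`, and `γ`, `γ - id` are injective on `E` with derivatives
bounded below by `m` and `n`. -/
structure Piece (γ γ' : ℝ → ℝ) (E : Set ℝ) (ℓ m n Λ : ℝ) : Prop where
  measurableSet : MeasurableSet E
  subset_Icc : ∃ a, E ⊆ Icc a (a + ℓ)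
  image_subset_Icc : ∃ b, ∀ t ∈ E, γ t ∈ Icc b (b + Λ)
  length_le : ℓ ≤ Λ
  pos_m : 0 < m
  pos_n : 0 < n
  pos_Λ : 0 < Λ
  hasDerivAt : ∀ t ∈ E, HasDerivAt γ (γ' t) t
  m_le : ∀ t ∈ E, m ≤ |γ' t|
  n_le : ∀ t ∈ E, n ≤ |γ' t - 1|
  injOn : InjOn γ E
  injOn_sub : InjOn (fun t => γ t - t) E

/-- The factor |ψ'| / n is at least 1 on `E`; inserting it produces the Jacobian of an injective
change of variables. -/
theorem lintegral_comp_le {ψ ψ' : ℝ → ℝ} {E : Set ℝ} (hE : MeasurableSet E) {n : ℝ} (hn : 0 < n)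
    (hd : ∀ t ∈ E, HasDerivAt ψ (ψ' t) t) (hle : ∀ t ∈ E, n ≤ |ψ' t|) (hinj : InjOn ψ E)
    {h : ℝ → ℝ≥0∞} :
    ∫⁻ t in E, h (ψ t) ≤ ENNReal.ofReal (1 / n) * ∫⁻ s, h s := by
  have key := lintegral_image_eq_lintegral_abs_deriv_mul hE
    (fun t ht => (hd t ht).hasDerivWithinAt) hinj h
  calc ∫⁻ t in E, h (ψ t)
      ≤ ∫⁻ t in E, ENNReal.ofReal (1 / n) * (ENNReal.ofReal |ψ' t| * h (ψ t)) := by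
        refine setLIntegral_mono' hE fun t ht => ?_
        rw [← mul_assoc, ← ENNReal.ofReal_mul (by positivity)]
        refine le_mul_of_one_le_left zero_le ?_
        rw [ENNReal.one_le_ofReal, one_div, inv_mul_eq_div, one_le_div hn]
        exact hle t ht
    _ = ENNReal.ofReal (1 / n) * ∫⁻ t in E, ENNReal.ofReal |ψ' t| * h (ψ t) :=
        lintegral_const_mul' _ _ ENNReal.ofReal_ne_top
    _ = ENNReal.ofReal (1 / n) * ∫⁻ s in ψ '' E, h s := by rw [key]
    _ ≤ _ := mul_le_mul_right (setLIntegral_le_lintegral _ _) _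

theorem measurableSet_strip (p q : ℝ) :
    MeasurableSet {w : ℝ × ℝ | w.2 ∈ Icc (w.1 + p) (w.1 + q)} :=
  (measurableSet_le (f := fun w : ℝ × ℝ => w.1 + p) (g := fun w => w.2)
    (by fun_prop) (by fun_prop)).inter
    (measurableSet_le (f := fun w : ℝ × ℝ => w.2) (g := fun w => w.1 + q)
      (by fun_prop) (by fun_prop))

/-- By Tonelli: a given z lies in the moving window for y in an interval of length q - p. -/
theorem lintegral_setLIntegral_Icc {h : ℝ → ℝ≥0∞} (hh : Measurable h) (p q : ℝ) :
    ∫⁻ y, ∫⁻ z in Icc (y + p) (y + q), h z = ENNReal.ofReal (q - p) * ∫⁻ z, h z := by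
  have hS := measurableSet_strip p q
  calc ∫⁻ y, ∫⁻ z in Icc (y + p) (y + q), h z
      = ∫⁻ y, ∫⁻ z, {w : ℝ × ℝ | w.2 ∈ Icc (w.1 + p) (w.1 + q)}.indicator
          (fun w => h w.2) (y, z) := by
        refine lintegral_congr fun y => ?_
        rw [← lintegral_indicator measurableSet_Icc]
        rfl
    _ = ∫⁻ z, ∫⁻ y, {w : ℝ × ℝ | w.2 ∈ Icc (w.1 + p) (w.1 + q)}.indicator
          (fun w => h w.2) (y, z) := by
        refine lintegral_lintegral_swap (f := fun y z =>
          {w : ℝ × ℝ | w.2 ∈ Icc (w.1 + p) (w.1 + q)}.indicator (fun w => h w.2) (y, z)) ?_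
        exact ((hh.comp measurable_snd).indicator hS).aemeasurable
    _ = ∫⁻ z, ENNReal.ofReal (q - p) * h z := by
        refine lintegral_congr fun z => ?_
        have : (fun y => {w : ℝ × ℝ | w.2 ∈ Icc (w.1 + p) (w.1 + q)}.indicator
            (fun w => h w.2) (y, z)) = (Icc (z - q) (z - p)).indicator fun _ => h z := by
          funext y
          by_cases hy : y ∈ Icc (z - q) (z - p)
          · have : (y, z) ∈ {w : ℝ × ℝ | w.2 ∈ Icc (w.1 + p) (w.1 + q)} :=
              ⟨by linarith [hy.2], by linarith [hy.1]⟩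
            rw [indicator_of_mem hy, indicator_of_mem this]
          · have : (y, z) ∉ {w : ℝ × ℝ | w.2 ∈ Icc (w.1 + p) (w.1 + q)} :=
              fun h' => hy ⟨by linarith [h'.2], by linarith [h'.1]⟩
            rw [indicator_of_notMem hy, indicator_of_notMem this]
        rw [this, lintegral_indicator_const measurableSet_Icc, Real.volume_Icc, mul_comm]
        congr 2
        ring
    _ = _ := lintegral_const_mul _ hh

theorem lintegral_mul_sqrt_le (μ : Measure ℝ) {h k : ℝ → ℝ≥0∞} (hh : AEMeasurable h μ)
    (hk : AEMeasurable k μ) :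
    ∫⁻ x, h x ^ (1 / 2 : ℝ) * k x ^ (1 / 2 : ℝ) ∂μ ≤
      (∫⁻ x, h x ∂μ) ^ (1 / 2 : ℝ) * (∫⁻ x, k x ∂μ) ^ (1 / 2 : ℝ) := by
  have := ENNReal.lintegral_mul_le_Lp_mul_Lq μ Real.HolderConjugate.two_two
    (hh.pow_const (1 / 2 : ℝ)) (hk.pow_const (1 / 2 : ℝ))
  simpa only [Pi.mul_apply, ← ENNReal.rpow_mul, one_div, inv_mul_cancel₀ (two_ne_zero' ℝ),
    ENNReal.rpow_one] using this

namespace Piece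

variable {γ γ' : ℝ → ℝ} {E : Set ℝ} {ℓ m n Λ : ℝ}

theorem volume_le (h : Piece γ γ' E ℓ m n Λ) : volume E ≤ ENNReal.ofReal ℓ := by
  obtain ⟨a, ha⟩ := h.subset_Icc
  refine (measure_mono ha).trans (le_of_eq ?_)
  rw [Real.volume_Icc, add_sub_cancel_left]

/-- Translating x by t moves all dependence on t into G(x - (γ(t) - t)). The relevant Jacobian is
therefore γ' - 1, which is where `n` enters. -/
theorem lintegral_posForm_le (hγ : Measurable γ) (h : Piece γ γ' E ℓ m n Λ) {F G : ℝ → ℝ≥0∞}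
    (hF : Measurable F) (hG : Measurable G) :
    ∫⁻ x, posForm γ (volume.restrict E) F G x ≤
      ENNReal.ofReal (1 / n) * (∫⁻ y, F y) * ∫⁻ y, G y := by
  calc ∫⁻ x, posForm γ (volume.restrict E) F G x
      = ∫⁻ t in E, ∫⁻ x, F (x - t) * G (x - γ t) :=
        lintegral_lintegral_swap (measurable_posForm_integrand hγ hF hG).aemeasurable
    _ = ∫⁻ t in E, ∫⁻ x, F x * G (x - (γ t - t)) := by
        refine lintegral_congr fun t => ?_
        rw [← lintegral_sub_right_eq_self (fun x => F x * G (x - (γ t - t))) t]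
        refine lintegral_congr fun x => ?_
        rw [show x - t - (γ t - t) = x - γ t by ring]
    _ = ∫⁻ x, ∫⁻ t in E, F x * G (x - (γ t - t)) := by
        refine lintegral_lintegral_swap (f := fun t x => F x * G (x - (γ t - t))) ?_
        refine Measurable.aemeasurable ?_
        exact (hF.comp measurable_snd).mul (hG.comp (measurable_snd.sub
          ((hγ.comp measurable_fst).sub measurable_fst)))
    _ ≤ ∫⁻ x, F x * (ENNReal.ofReal (1 / n) * ∫⁻ y, G y) := by
        refine lintegral_mono fun x => ?_
        rw [lintegral_const_mul]
        · refine mul_le_mul_right ?_ _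
          refine (lintegral_comp_le (ψ := fun t => γ t - t) (ψ' := fun t => γ' t - 1)
            (h := fun s => G (x - s)) h.measurableSet h.pos_n
            (fun t ht => (h.hasDerivAt t ht).sub (hasDerivAt_id t)) h.n_le h.injOn_sub).trans ?_
          rw [lintegral_sub_left_eq_self (fun y => G y) x]
        · exact hG.comp (measurable_const.sub (hγ.sub measurable_id))
    _ = _ := by
        rw [lintegral_mul_const _ hF]
        ring

theorem hasBound_zero_zero_zero (h : Piece γ γ' E ℓ m n Λ) :
    HasBound γ (volume.restrict E) (0, 0, 0) (ENNReal.ofReal ℓ) := by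
  intro F G _ _
  refine Or.inl ⟨rfl, fun x => ?_⟩
  simpa [posForm] using h.volume_le

theorem hasBound_one_zero_zero :
    HasBound γ (volume.restrict E) (1, 0, 0) 1 := by
  intro F G _ _
  refine Or.inl ⟨rfl, fun x => ?_⟩
  simp only [posForm, ENNReal.rpow_one, ENNReal.rpow_zero, mul_one, one_mul]
  refine (setLIntegral_le_lintegral _ _).trans (le_of_eq ?_)
  exact lintegral_sub_left_eq_self (fun y => F y) x

theorem hasBound_zero_one_zero (h : Piece γ γ' E ℓ m n Λ) :
    HasBound γ (volume.restrict E) (0, 1, 0) (ENNReal.ofReal (1 / m)) := by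
  intro F G _ _
  refine Or.inl ⟨rfl, fun x => ?_⟩
  simp only [posForm, ENNReal.rpow_one, ENNReal.rpow_zero, mul_one, one_mul]
  refine (lintegral_comp_le (h := fun s => G (x - s)) h.measurableSet h.pos_m h.hasDerivAt h.m_le
    h.injOn).trans (le_of_eq ?_)
  rw [lintegral_sub_left_eq_self (fun y => G y) x]

theorem hasBound_one_zero_one (h : Piece γ γ' E ℓ m n Λ) :
    HasBound γ (volume.restrict E) (1, 0, 1) (ENNReal.ofReal ℓ) := by
  intro F G hF _
  refine Or.inr ⟨one_pos, ?_⟩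
  simp only [posForm, ENNReal.rpow_one, ENNReal.rpow_zero, mul_one, div_one]
  rw [lintegral_lintegral_swap (f := fun x t => F (x - t))
    (hF.comp (measurable_fst.sub measurable_snd)).aemeasurable]
  simp only [lintegral_sub_right_eq_self fun y => F y, lintegral_const, Measure.restrict_apply_univ]
  rw [mul_comm]
  exact mul_le_mul_left h.volume_le _

theorem hasBound_zero_one_one (hγ : Measurable γ) (h : Piece γ γ' E ℓ m n Λ) :
    HasBound γ (volume.restrict E) (0, 1, 1) (ENNReal.ofReal ℓ) := by
  intro F G _ hG
  refine Or.inr ⟨one_pos, ?_⟩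
  simp only [posForm, ENNReal.rpow_one, ENNReal.rpow_zero, mul_one, one_mul, div_one]
  rw [lintegral_lintegral_swap (f := fun x t => G (x - γ t))
    (hG.comp (measurable_fst.sub (hγ.comp measurable_snd))).aemeasurable]
  simp only [lintegral_sub_right_eq_self fun y => G y, lintegral_const, Measure.restrict_apply_univ]
  rw [mul_comm]
  exact mul_le_mul_left h.volume_le _

theorem hasBound_one_one_one (hγ : Measurable γ) (h : Piece γ γ' E ℓ m n Λ) :
    HasBound γ (volume.restrict E) (1, 1, 1) (ENNReal.ofReal (1 / n)) := by
  intro F G hF hG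
  refine Or.inr ⟨one_pos, ?_⟩
  simpa only [ENNReal.rpow_one, div_one] using h.lintegral_posForm_le hγ hF hG

/-- The bound into `L^{1/2}`: localise `x` to intervals of length `Λ`, on which only pieces of `F`
and `G` of comparable length contribute, and use the Cauchy-Schwarz inequality twice. -/
theorem hasBound_one_one_two (hγ : Measurable γ) (h : Piece γ γ' E ℓ m n Λ) :
    HasBound γ (volume.restrict E) (1, 1, 2) (ENNReal.ofReal (4 * (Λ / n))) := by
  intro F G hF hG
  refine Or.inr ⟨two_pos, ?_⟩
  simp only [ENNReal.rpow_one]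
  obtain ⟨a, ha⟩ := h.subset_Icc
  obtain ⟨b, hb⟩ := h.image_subset_Icc
  have hΛ := h.pos_Λ
  have hn := h.pos_n
  set T := posForm γ (volume.restrict E) F G with hT
  have hTm : Measurable T := measurable_posForm hγ _ hF hG
  -- `A y` and `B y` are the masses of F and G on windows containing every x - t and x - γ(t) with x
  -- in [y, y + Λ] and t in `E`.
  set A : ℝ → ℝ≥0∞ := fun y => ∫⁻ z in Icc (y + (-Λ - a)) (y + (Λ - a)), F z with hA
  set B : ℝ → ℝ≥0∞ := fun y => ∫⁻ z in Icc (y + (-Λ - b)) (y + (Λ - b)), G z with hB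
  have hmeas : ∀ (k : ℝ → ℝ≥0∞) (p q : ℝ), Measurable k →
      Measurable fun y : ℝ => ∫⁻ z in Icc (y + p) (y + q), k z := by
    intro k p q hk
    have hS := measurableSet_strip p q
    have := ((hk.comp measurable_snd).indicator hS).lintegral_prod_right' (ν := volume)
    convert this using 2 with y
    rw [← lintegral_indicator measurableSet_Icc]
    rfl
  have hAm : Measurable A := hmeas F _ _ hF
  have hBm : Measurable B := hmeas G _ _ hG
  have hAint : ∫⁻ y, A y = ENNReal.ofReal (2 * Λ) * ∫⁻ z, F z := by
    rw [hA, lintegral_setLIntegral_Icc hF]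
    congr 2
    ring
  have hBint : ∫⁻ y, B y = ENNReal.ofReal (2 * Λ) * ∫⁻ z, G z := by
    rw [hB, lintegral_setLIntegral_Icc hG]
    congr 2
    ring
  have hloc : ∀ y, ∫⁻ x in Icc (y + 0) (y + Λ), T x ≤ ENNReal.ofReal (1 / n) * A y * B y := by
    intro y
    set J := Icc (y + (-Λ - a)) (y + (Λ - a))
    set J' := Icc (y + (-Λ - b)) (y + (Λ - b))
    calc ∫⁻ x in Icc (y + 0) (y + Λ), T x
        ≤ ∫⁻ x in Icc (y + 0) (y + Λ),
            posForm γ (volume.restrict E) (J.indicator F) (J'.indicator G) x := by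
          refine setLIntegral_mono' measurableSet_Icc fun x hx => ?_
          refine setLIntegral_mono' h.measurableSet fun t ht => ?_
          have h1 : x - t ∈ J :=
            ⟨by linarith [hx.1, (ha ht).2, h.length_le], by linarith [hx.2, (ha ht).1]⟩
          have h2 : x - γ t ∈ J' :=
            ⟨by linarith [hx.1, (hb t ht).2], by linarith [hx.2, (hb t ht).1]⟩
          rw [indicator_of_mem h1, indicator_of_mem h2]
      _ ≤ ∫⁻ x, posForm γ (volume.restrict E) (J.indicator F) (J'.indicator G) x :=
          setLIntegral_le_lintegral _ _
      _ ≤ _ := h.lintegral_posForm_le hγ (hF.indicator measurableSet_Icc)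
          (hG.indicator measurableSet_Icc)
      _ = _ := by
          rw [lintegral_indicator measurableSet_Icc, lintegral_indicator measurableSet_Icc]
  -- First Cauchy-Schwarz, against the constant 1 on an interval of length Λ.
  have hsqrt : ∀ y, ∫⁻ x in Icc (y + 0) (y + Λ), T x ^ (1 / 2 : ℝ) ≤
      (ENNReal.ofReal (1 / n) * ENNReal.ofReal Λ) ^ (1 / 2 : ℝ) *
        (A y ^ (1 / 2 : ℝ) * B y ^ (1 / 2 : ℝ)) := by
    intro y
    have h1 := lintegral_mul_sqrt_le (volume.restrict (Icc (y + 0) (y + Λ)))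
      hTm.aemeasurable (k := fun _ => 1) aemeasurable_const
    simp only [ENNReal.one_rpow, mul_one, lintegral_const, one_mul, Measure.restrict_apply_univ,
      Real.volume_Icc, add_sub_add_left_eq_sub, sub_zero] at h1
    refine h1.trans ?_
    rw [← ENNReal.mul_rpow_of_nonneg _ _ (by norm_num), ← ENNReal.mul_rpow_of_nonneg _ _
      (by norm_num), ← ENNReal.mul_rpow_of_nonneg _ _ (by norm_num)]
    refine ENNReal.rpow_le_rpow ?_ (by norm_num)
    refine (mul_le_mul_left (hloc y) _).trans (le_of_eq ?_)
    ring
  -- Integrating in y counts each x with weight Λ. The second Cauchy-Schwarz separates A from B,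
  -- each of total mass 2Λ times that of F or G; since (1/n) Λ (2Λ)² = Λ² · 4Λ/n, one Λ cancels and
  -- the constant 4Λ/n remains.
  have hmain : ENNReal.ofReal Λ * ∫⁻ x, T x ^ (1 / 2 : ℝ) ≤
      ENNReal.ofReal Λ * (ENNReal.ofReal (4 * (Λ / n)) * (∫⁻ y, F y) * ∫⁻ y, G y) ^ (1 / 2 : ℝ) := by
    calc ENNReal.ofReal Λ * ∫⁻ x, T x ^ (1 / 2 : ℝ)
        = ∫⁻ y, ∫⁻ x in Icc (y + 0) (y + Λ), T x ^ (1 / 2 : ℝ) := by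
          rw [lintegral_setLIntegral_Icc (hTm.pow_const _), sub_zero]
      _ ≤ _ := lintegral_mono hsqrt
      _ = (ENNReal.ofReal (1 / n) * ENNReal.ofReal Λ) ^ (1 / 2 : ℝ) *
            ∫⁻ y, A y ^ (1 / 2 : ℝ) * B y ^ (1 / 2 : ℝ) :=
          lintegral_const_mul _ ((hAm.pow_const _).mul (hBm.pow_const _))
      _ ≤ _ := mul_le_mul_right
          (lintegral_mul_sqrt_le volume hAm.aemeasurable hBm.aemeasurable) _
      _ = _ := by
          have h2 : ENNReal.ofReal Λ = (ENNReal.ofReal (Λ * Λ)) ^ (1 / 2 : ℝ) := by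
            rw [ENNReal.ofReal_rpow_of_nonneg (by positivity) (by norm_num), ← Real.sqrt_eq_rpow,
              Real.sqrt_mul_self hΛ.le]
          rw [hAint, hBint]
          conv_rhs => rw [h2]
          rw [← ENNReal.mul_rpow_of_nonneg _ _ (by norm_num), ← ENNReal.mul_rpow_of_nonneg _ _
            (by norm_num), ← ENNReal.mul_rpow_of_nonneg _ _ (by norm_num)]
          congr 1
          have h3 : ENNReal.ofReal (1 / n) * ENNReal.ofReal Λ *
              (ENNReal.ofReal (2 * Λ) * ENNReal.ofReal (2 * Λ)) =
              ENNReal.ofReal (Λ * Λ) * ENNReal.ofReal (4 * (Λ / n)) := by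
            rw [← ENNReal.ofReal_mul (by positivity), ← ENNReal.ofReal_mul (by positivity),
              ← ENNReal.ofReal_mul (by positivity), ← ENNReal.ofReal_mul (by positivity)]
            congr 1
            ring
          calc _ = ENNReal.ofReal (1 / n) * ENNReal.ofReal Λ *
              (ENNReal.ofReal (2 * Λ) * ENNReal.ofReal (2 * Λ)) * (∫⁻ y, F y) * ∫⁻ y, G y := by
                ring
            _ = _ := by rw [h3]; ring
  rwa [ENNReal.mul_le_mul_iff_right (by simpa using hΛ) ENNReal.ofReal_ne_top] at hmain

end Piece

/-! ### Averaged decay exponents and extrapolation. -/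

/-- The exponent triples at which a piece is estimated directly. -/
def vertex : Fin 7 → ℝ × ℝ × ℝ :=
  ![(0, 0, 0), (1, 0, 0), (0, 1, 0), (1, 0, 1), (0, 1, 1), (1, 1, 1), (1, 1, 2)]

/-- The constants of a piece at the points `vertex i`. -/
def pieceConst (ℓ m n Λ : ℝ) : Fin 7 → ℝ :=
  ![ℓ, 1, 1 / m, ℓ, ℓ, 1 / n, 4 * (Λ / n)]

/-- The decay exponents of a family of pieces at the points `vertex i`. -/
def decay (eℓ em en eΛ : ℝ) : Fin 7 → ℝ :=
  ![eℓ, 0, em, eℓ, eℓ, en, eΛ]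

/-- `P` is a convex combination of the vertices whose averaged decay exponent is at least `s`. -/
def Attains (e : Fin 7 → ℝ) (s : ℝ) (P : ℝ × ℝ × ℝ) : Prop :=
  ∃ θ : Fin 7 → ℝ, (∀ i, 0 ≤ θ i) ∧ ∑ i, θ i = 1 ∧
    P = (∑ i, θ i * (vertex i).1, ∑ i, θ i * (vertex i).2.1, ∑ i, θ i * (vertex i).2.2) ∧
    s ≤ ∑ i, θ i * e i

theorem Piece.hasBound_vertex {γ γ' : ℝ → ℝ} (hγ : Measurable γ) {E : Set ℝ} {ℓ m n Λ : ℝ}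
    (h : Piece γ γ' E ℓ m n Λ) (i : Fin 7) :
    HasBound γ (volume.restrict E) (vertex i) (ENNReal.ofReal (pieceConst ℓ m n Λ i)) := by
  fin_cases i
  · exact h.hasBound_zero_zero_zero
  · have := Piece.hasBound_one_zero_zero (γ := γ) (E := E)
    simpa [vertex, pieceConst] using this
  · exact h.hasBound_zero_one_zero
  · exact h.hasBound_one_zero_one
  · exact h.hasBound_zero_one_one hγ
  · exact h.hasBound_one_one_one hγ
  · exact h.hasBound_one_one_two hγ

theorem Attains.combine {e : Fin 7 → ℝ} {s s' a b : ℝ} {P Q : ℝ × ℝ × ℝ} (hP : Attains e s P)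
    (hQ : Attains e s' Q) (ha : 0 ≤ a) (hb : 0 ≤ b) (hab : a + b = 1) :
    Attains e (a * s + b * s') (a • P + b • Q) := by
  obtain ⟨θ, h0, h1, rfl, hs⟩ := hP
  obtain ⟨θ', h0', h1', rfl, hs'⟩ := hQ
  have key : ∀ c : Fin 7 → ℝ, ∑ i, (a * θ i + b * θ' i) * c i =
      a * ∑ i, θ i * c i + b * ∑ i, θ' i * c i := by
    intro c
    rw [Finset.mul_sum, Finset.mul_sum, ← Finset.sum_add_distrib]
    exact Finset.sum_congr rfl fun i _ => by ring
  refine ⟨fun i => a * θ i + b * θ' i, fun i => ?_, ?_, ?_, ?_⟩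
  · have := h0 i
    have := h0' i
    positivity
  · rw [Finset.sum_add_distrib, ← Finset.mul_sum, ← Finset.mul_sum, h1, h1']
    linarith
  · rw [key, key, key]
    rfl
  · rw [key]
    gcongr

theorem Attains.mono {e : Fin 7 → ℝ} {s s' : ℝ} {P : ℝ × ℝ × ℝ} (hP : Attains e s P)
    (hs : s' ≤ s) : Attains e s' P := by
  obtain ⟨θ, h0, h1, h2, h3⟩ := hP
  exact ⟨θ, h0, h1, h2, hs.trans h3⟩

theorem convex_attains (e : Fin 7 → ℝ) (s : ℝ) : Convex ℝ {P | Attains e s P} := by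
  intro P hP Q hQ a b ha hb hab
  refine (Attains.combine hP hQ ha hb hab).mono (le_of_eq ?_)
  rw [← add_mul, hab, one_mul]

theorem attains_vertex (e : Fin 7 → ℝ) (i : Fin 7) : Attains e (e i) (vertex i) := by
  refine ⟨fun j => if j = i then 1 else 0, fun j => ?_, ?_, ?_, ?_⟩
  · positivity
  · simp
  · simp
  · simp

/-- An interior point of a set lies strictly between a point of the set and any given point. -/
theorem exists_extrapolation {S : Set (ℝ × ℝ × ℝ)} {P : ℝ × ℝ × ℝ} (hP : P ∈ interior S)
    (y : ℝ × ℝ × ℝ) : ∃ δ : ℝ, 0 < δ ∧ δ < 1 ∧ ∃ Q ∈ S, P = (1 - δ) • Q + δ • y := by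
  -- Solving P = (1 - δ)Q + δy for Q gives a point that tends to P as δ → 0.
  have hcont : ContinuousAt (fun δ : ℝ => (1 - δ)⁻¹ • (P - δ • y)) 0 := by
    have h1 : ContinuousAt (fun δ : ℝ => (1 - δ)⁻¹) 0 :=
      ContinuousAt.inv₀ (f := fun δ : ℝ => 1 - δ) (by fun_prop) (by norm_num)
    have h2 : ContinuousAt (fun δ : ℝ => P - δ • y) 0 := by fun_prop
    exact h1.smul h2
  have hmem : ∀ᶠ δ in 𝓝 (0 : ℝ), (1 - δ)⁻¹ • (P - δ • y) ∈ S := by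
    refine hcont.eventually ?_
    simpa using mem_interior_iff_mem_nhds.1 hP
  have h2 : ∀ᶠ δ in 𝓝[>] (0 : ℝ), (1 - δ)⁻¹ • (P - δ • y) ∈ S := nhdsWithin_le_nhds hmem
  have h3 : ∀ᶠ δ in 𝓝[>] (0 : ℝ), δ ∈ Ioo (0 : ℝ) 1 := Ioo_mem_nhdsGT one_pos
  obtain ⟨δ, hδ, h0, h1⟩ := (h2.and h3).exists
  refine ⟨δ, h0, h1, _, hδ, ?_⟩
  rw [smul_smul, mul_inv_cancel₀ (by linarith), one_smul, sub_add_cancel]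

/-! ### Summing a sequence of pieces against the weight. -/

/-- The measure `t^{α-1} dt` on `S`. -/
def weighted (α : ℝ) (S : Set ℝ) : Measure ℝ :=
  (volume.restrict S).withDensity fun t => ENNReal.ofReal (t ^ (α - 1))

theorem weighted_le_sum {α : ℝ} {S : Set ℝ} {E : ℕ → Set ℝ} (hE : ∀ j, MeasurableSet (E j))
    (hS : S ⊆ ⋃ j, E j) {c : ℕ → ℝ≥0∞} (hc : ∀ j, ∀ t ∈ E j, ENNReal.ofReal (t ^ (α - 1)) ≤ c j) :
    weighted α S ≤ Measure.sum fun j => c j • volume.restrict (E j) := by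
  refine Measure.le_iff.2 fun B hB => ?_
  rw [weighted, withDensity_apply _ hB, Measure.sum_apply _ hB, Measure.restrict_restrict hB]
  calc ∫⁻ t in B ∩ S, ENNReal.ofReal (t ^ (α - 1))
      ≤ ∫⁻ t in ⋃ j, B ∩ E j, ENNReal.ofReal (t ^ (α - 1)) := by
        refine lintegral_mono_set ?_
        rw [← inter_iUnion]
        exact inter_subset_inter_right _ hS
    _ ≤ ∑' j, ∫⁻ t in B ∩ E j, ENNReal.ofReal (t ^ (α - 1)) := lintegral_iUnion_le _ _
    _ ≤ _ := by
        refine ENNReal.tsum_le_tsum fun j => ?_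
        refine (setLIntegral_mono' (g := fun _ => c j) (hB.inter (hE j))
          fun t ht => hc j t ht.2).trans (le_of_eq ?_)
        rw [setLIntegral_const, Measure.smul_apply, Measure.restrict_apply hB, smul_eq_mul]

/-- Inclusion up to a null set is needed because the pieces in the middle range omit the points
where γ' = 1. -/
theorem weighted_mono_ae {α : ℝ} {S S' : Set ℝ} (h : S ≤ᵐ[volume] S') :
    weighted α S ≤ weighted α S' := by
  refine Measure.le_iff.2 fun B hB => ?_
  rw [weighted, weighted, withDensity_apply _ hB, withDensity_apply _ hB]
  exact lintegral_mono' (Measure.restrict_mono le_rfl (Measure.restrict_mono' h le_rfl)) le_rfl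

/-- Interpolation on the j-th piece gives a constant 4C·2^{-jσ} with σ ≥ s, and the weight
contributes C·2^{-jη}. As s + η > 0, every positive power of the product is summable. -/
theorem exists_hasBound_of_pieces {γ γ' : ℝ → ℝ} (hγ : Measurable γ) {E : ℕ → Set ℝ}
    {ℓ m n Λ : ℕ → ℝ} (hE : ∀ j, Piece γ γ' (E j) (ℓ j) (m j) (n j) (Λ j))
    {eℓ em en eΛ η C α : ℝ} (hC : 1 ≤ C)
    (hℓ : ∀ j : ℕ, ℓ j ≤ C * 2 ^ (-(j * eℓ))) (hm : ∀ j : ℕ, 1 / m j ≤ C * 2 ^ (-(j * em)))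
    (hn : ∀ j : ℕ, 1 / n j ≤ C * 2 ^ (-(j * en)))
    (hΛ : ∀ j : ℕ, Λ j / n j ≤ C * 2 ^ (-(j * eΛ)))
    {S : Set ℝ} (hS : S ⊆ ⋃ j, E j)
    (hη : ∀ j : ℕ, ∀ t ∈ E j, t ^ (α - 1) ≤ C * 2 ^ (-(j * η)))
    {P : ℝ × ℝ × ℝ} {s : ℝ} (hP : Attains (decay eℓ em en eΛ) s P) (hs : 0 < s + η)
    (hP2 : 0 < P.2.2) : ∃ K : ℝ≥0∞, K ≠ ∞ ∧ HasBound γ (weighted α S) P K := by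
  obtain ⟨θ, h0, h1, hPθ, hsθ⟩ := hP
  set e := decay eℓ em en eΛ with he
  set σ := ∑ i, θ i * e i with hσ
  have hC0 : 0 < C := by linarith
  -- The 4 absorbs the factor in the L^{1/2} bound, and C ≥ 1 covers the constant 1 at (1, 0, 0). A
  -- common constant survives interpolation because the weights sum to 1.
  have hvert : ∀ (j : ℕ) (i : Fin 7), HasBound γ (volume.restrict (E j)) (vertex i)
      (ENNReal.ofReal (4 * C * 2 ^ (-(j * e i)))) := by
    intro j i
    refine ((hE j).hasBound_vertex hγ i).mono (ENNReal.ofReal_le_ofReal ?_)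
    have hx : ∀ x y : ℝ, x ≤ C * 2 ^ y → x ≤ 4 * C * 2 ^ y := by
      intro x y hxy
      have : 0 < C * (2 : ℝ) ^ y := by positivity
      linarith
    fin_cases i
    · exact hx _ _ (hℓ j)
    · refine hx _ _ ?_
      simpa [pieceConst, he, decay] using hC
    · exact hx _ _ (hm j)
    · exact hx _ _ (hℓ j)
    · exact hx _ _ (hℓ j)
    · exact hx _ _ (hn j)
    · have := hΛ j
      simp only [pieceConst, he, decay]
      change 4 * (Λ j / n j) ≤ 4 * C * 2 ^ (-(j * eΛ))
      linarith
  have hbound : ∀ j : ℕ, HasBound γ (volume.restrict (E j)) P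
      (ENNReal.ofReal (4 * C * 2 ^ (-(j * σ)))) := by
    intro j
    have hpos : 0 < ∑ i, θ i * (vertex i).2.2 := by
      rw [hPθ] at hP2
      exact hP2
    have := HasBound.interpolate hγ (V := vertex) (fun i => by fin_cases i <;> simp [vertex])
      (hvert j) h0 h1 hpos
    rw [← hPθ] at this
    convert this using 1
    have h4 : ∀ i, ENNReal.ofReal (4 * C * 2 ^ (-(j * e i))) ^ θ i =
        ENNReal.ofReal ((4 * C) ^ θ i * 2 ^ (-(j * (θ i * e i)))) := by
      intro i
      rw [ENNReal.ofReal_rpow_of_nonneg (by positivity) (h0 i),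
        Real.mul_rpow (by positivity) (by positivity), ← Real.rpow_mul (by norm_num)]
      congr 3
      ring
    rw [Finset.prod_congr rfl fun i _ => h4 i,
      ← ENNReal.ofReal_prod_of_nonneg fun i _ => by positivity, Finset.prod_mul_distrib,
      ← Real.rpow_sum_of_pos (by positivity), ← Real.rpow_sum_of_pos (by positivity), h1,
      Real.rpow_one, Finset.sum_neg_distrib, ← Finset.mul_sum]
  set c : ℕ → ℝ≥0∞ := fun j => ENNReal.ofReal (C * 2 ^ (-(j * η))) with hc
  set K : ℕ → ℝ≥0∞ := fun j => ENNReal.ofReal (4 * C ^ 2 * 2 ^ (-(j * (σ + η)))) with hK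
  have hcK : ∀ j : ℕ, c j * ENNReal.ofReal (4 * C * 2 ^ (-(j * σ))) = K j := by
    intro j
    simp only [hc, hK]
    rw [← ENNReal.ofReal_mul (by positivity)]
    congr 1
    rw [show -(j * (σ + η)) = -(j * η) + -(j * σ) by ring, Real.rpow_add (by norm_num)]
    ring
  have hsum : ∀ τ : ℝ, 0 < τ → ∑' j, K j ^ τ ≠ ∞ := by
    intro τ hτ
    have h5 : ∀ j : ℕ, K j ^ τ = ENNReal.ofReal ((4 * C ^ 2) ^ τ) *
        ENNReal.ofReal (2 ^ (-((σ + η) * τ))) ^ j := by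
      intro j
      simp only [hK]
      rw [ENNReal.ofReal_rpow_of_nonneg (by positivity) hτ.le,
        Real.mul_rpow (by positivity) (by positivity), ← Real.rpow_mul (by norm_num),
        ENNReal.ofReal_mul (by positivity), ← ENNReal.ofReal_pow (by positivity),
        ← Real.rpow_mul_natCast (by norm_num)]
      congr 3
      ring
    simp only [h5]
    rw [ENNReal.tsum_mul_left, ENNReal.tsum_geometric]
    refine ENNReal.mul_ne_top ENNReal.ofReal_ne_top (ENNReal.inv_ne_top.2 ?_)
    refine (tsub_pos_of_lt ?_).ne'
    rw [ENNReal.ofReal_lt_one]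
    exact Real.rpow_lt_one_of_one_lt_of_neg (by norm_num)
      (neg_neg_of_pos (mul_pos (by linarith) hτ))
  obtain ⟨D, hD, hDb⟩ := HasBound.sum hγ (μ := fun j => c j • volume.restrict (E j)) hP2 (K := K)
    (fun j => by simp only [hK]; exact (ENNReal.ofReal_pos.2 (by positivity)).ne')
    (fun j => ENNReal.ofReal_ne_top) hsum
    (fun j => by rw [← hcK]; exact (hbound j).smul hγ (c j))
  refine ⟨D, hD, hDb.mono_measure (weighted_le_sum (fun j => (hE j).measurableSet) hS ?_)⟩
  exact fun j t ht => ENNReal.ofReal_le_ofReal (hη j t ht)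

theorem exists_hasBound_union {γ : ℝ → ℝ} (hγ : Measurable γ) {α : ℝ} {S S' : Set ℝ}
    {P : ℝ × ℝ × ℝ} (hP : 0 < P.2.2)
    (h : ∃ K : ℝ≥0∞, K ≠ ∞ ∧ HasBound γ (weighted α S) P K)
    (h' : ∃ K : ℝ≥0∞, K ≠ ∞ ∧ HasBound γ (weighted α S') P K) :
    ∃ K : ℝ≥0∞, K ≠ ∞ ∧ HasBound γ (weighted α (S ∪ S')) P K := by
  obtain ⟨K, hK, hb⟩ := h
  obtain ⟨K', hK', hb'⟩ := h'
  have hsf : ∀ b : Bool, SFinite (weighted α (cond b S S')) := fun b => by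
    unfold weighted
    infer_instance
  obtain ⟨D, hD, hDb⟩ := HasBound.sum hγ (μ := fun b : Bool => weighted α (cond b S S')) hP
    -- The summand 1 keeps the constants nonzero, as `HasBound.sum` requires.
    (K := fun _ => K + K' + 1) (fun _ => by simp) (fun _ => by simp [hK, hK'])
    (fun τ hτ => by
      rw [tsum_fintype]
      exact ENNReal.sum_ne_top.2 fun b _ =>
        ENNReal.rpow_ne_top_of_nonneg hτ.le (by simp [hK, hK']))
    (fun b => by
      cases b
      · exact hb'.mono (le_add_right le_add_self)
      · exact hb.mono (le_add_right le_self_add))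
  refine ⟨D, hD, hDb.mono_measure ?_⟩
  refine Measure.le_iff.2 fun B hB => ?_
  rw [Measure.sum_apply _ hB, tsum_fintype, Fintype.sum_bool]
  simp only [cond_true, cond_false, weighted]
  rw [withDensity_apply _ hB, withDensity_apply _ hB, withDensity_apply _ hB,
    Measure.restrict_restrict hB, Measure.restrict_restrict hB, Measure.restrict_restrict hB,
    inter_union_distrib_left]
  exact lintegral_union_le _ _ _

/-! ### The points spanning the region in terms of the seven vertices. -/

theorem attains_of_eq {e : Fin 7 → ℝ} {κ s : ℝ} {P : ℝ × ℝ × ℝ} (i j : Fin 7) (h0 : 0 ≤ κ)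
    (h1 : κ ≤ 1) (hP : P = κ • vertex i + (1 - κ) • vertex j)
    (hs : s ≤ κ * e i + (1 - κ) * e j) : Attains e s P := by
  rw [hP]
  exact ((attains_vertex e i).combine (attains_vertex e j) h0 (by linarith) (by ring)).mono hs

/-- The geometric conditions on the decay exponents under which every point of the region
attains the exponent `s`. -/
theorem attains_of_mem_convexHull {α : ℝ} {γ : ℝ → ℝ} (hα₀ : 0 < α) (hα₁ : α < 1)
    (hw : 1 < omegaZero₂ γ) (hwW : omegaZero₂ γ ≤ omegaInfty₁ γ)
    {eℓ em en eΛ s : ℝ}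
    (hA : s ≤ (1 - α) * eℓ)
    (hD₁ : s ≤ α / omegaInfty₁ γ * em + (1 - α / omegaInfty₁ γ) * eℓ)
    (hD₂ : s ≤ α / omegaZero₂ γ * em + (1 - α / omegaZero₂ γ) * eℓ)
    (hH : s ≤ α / omegaInfty₁ γ * em + (1 - α / omegaInfty₁ γ) * eΛ)
    (hG₁ : omegaInfty₁ γ ≤ 2 * α → s ≤ (1 - α) / (2 - omegaInfty₁ γ) * (en + eℓ))
    (hG₂ : 2 * α < omegaInfty₁ γ →
      s ≤ α / omegaInfty₁ γ * en + (1 - α / omegaInfty₁ γ) * eℓ)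
    (hG₃ : 2 * α < omegaInfty₁ γ → s ≤ 1 / 2 * en + 1 / 2 * eℓ)
    {P : ℝ × ℝ × ℝ} (hP : P ∈ convexHull ℝ (commonVertices α γ ∪ extraVertices α γ)) :
    Attains (decay eℓ em en eΛ) s P := by
  refine convexHull_min ?_ (convex_attains (decay eℓ em en eΛ) s) hP
  have hW : 1 < omegaInfty₁ γ := hw.trans_le hwW
  have hκ : ∀ ω, 1 < ω → 0 ≤ α / ω ∧ α / ω ≤ 1 := by
    intro ω hω
    have : 0 < ω := by linarith
    exact ⟨by positivity, (div_le_one this).2 (by linarith)⟩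
  have hC : ∀ ω, 1 < ω → s ≤ α / ω * em + (1 - α / ω) * eℓ →
      Attains (decay eℓ em en eΛ) s (0, α / ω, 0) := fun ω hω h =>
    attains_of_eq 2 0 (hκ ω hω).1 (hκ ω hω).2 (by simp [vertex]) h
  have hD : ∀ ω, 1 < ω → s ≤ α / ω * em + (1 - α / ω) * eℓ →
      Attains (decay eℓ em en eΛ) s (0, 1, 1 - α / ω) := fun ω hω h =>
    attains_of_eq 2 4 (hκ ω hω).1 (hκ ω hω).2 (by simp [vertex]) h
  rintro Q (hQ | hQ)
  · rcases hQ with rfl | rfl | rfl | rfl | rfl | rfl | rfl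
    · refine attains_of_eq 1 0 hα₀.le hα₁.le (by simp [vertex]) ?_
      simpa [decay] using hA
    · refine attains_of_eq 1 3 hα₀.le hα₁.le (by simp [vertex]) ?_
      simpa [decay] using hA
    · exact hC _ hW hD₁
    · exact hC _ hw hD₂
    · exact hD _ hW hD₁
    · exact hD _ hw hD₂
    -- H lies between (0, 1, 0) and (1, 1, 2); it is the only spanning point that calls for the
    -- L^{1/2} estimate.
    · refine attains_of_eq 2 6 (hκ _ hW).1 (hκ _ hW).2 ?_ hH
      have h0 : omegaInfty₁ γ ≠ 0 := by linarith
      simp only [vertex]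
      ext <;> simp <;> field_simp
  · unfold extraVertices at hQ
    split_ifs at hQ with h2
    · rw [mem_singleton_iff] at hQ
      subst hQ
      set σ := (1 - α) / (2 - omegaInfty₁ γ) with hσ
      have h3 : 0 < 2 - omegaInfty₁ γ := by linarith
      have hσ0 : 0 ≤ σ := div_nonneg (by linarith) h3.le
      -- G₁ = (1, σ, 2σ) lies between (1, 0, 0) and the midpoint (1, 1/2, 1) of vertices 5 and 3,
      -- with weight 2σ on the latter. The condition 2σ ≤ 1 is exactly ω_{∞,1} ≤ 2α.
      have hσ1 : 2 * σ ≤ 1 := by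
        rw [hσ, ← mul_div_assoc, div_le_one h3]
        linarith
      have hmid : Attains (decay eℓ em en eΛ) (1 / 2 * en + (1 - 1 / 2) * eℓ)
          ((1 / 2 : ℝ) • vertex 5 + (1 - 1 / 2 : ℝ) • vertex 3) :=
        attains_of_eq 5 3 (by norm_num) (by norm_num) rfl le_rfl
      have := (hmid.combine (attains_vertex _ 1) (a := 2 * σ) (b := 1 - 2 * σ) (by linarith)
        (by linarith) (by ring)).mono (s' := s) (by
          have := hG₁ h2
          simp only [decay]
          change s ≤ 2 * σ * (1 / 2 * en + (1 - 1 / 2) * eℓ) + (1 - 2 * σ) * 0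
          linarith)
      rw [mem_ofPred_eq]
      convert this using 1
      simp only [vertex, mul_div_assoc, ← hσ]
      ext <;> simp
      ring
    · rw [not_le] at h2
      rcases hQ with rfl | rfl
      · exact attains_of_eq 5 3 (hκ _ hW).1 (hκ _ hW).2 (by simp [vertex]) (hG₂ h2)
      · refine attains_of_eq (κ := 1 / 2) 5 3 (by norm_num) (by norm_num) ?_ ?_
        · simp only [vertex]
          ext <;> simp
        · have := hG₃ h2
          simp only [decay]
          change s ≤ 1 / 2 * en + (1 - 1 / 2) * eℓ
          linarith

theorem attains_of_extrapolation {e : Fin 7 → ℝ} {P : ℝ × ℝ × ℝ} {δ s s' : ℝ}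
    {i : Fin 7} {Q : ℝ × ℝ × ℝ} (hδ : 0 < δ) (hδ1 : δ < 1) (hP : P = (1 - δ) • Q + δ • vertex i)
    (hQ : Attains e s Q) (hs : s' ≤ (1 - δ) * s + δ * e i) : Attains e s' P := by
  rw [hP]
  exact (hQ.combine (attains_vertex e i) (by linarith) hδ.le (by ring)).mono hs

/-- All exponents of a point of the region are positive. -/
theorem pos_of_mem_region {α : ℝ} {γ : ℝ → ℝ} (hα₀ : 0 < α) (hα₁ : α < 1)
    (hw : 1 < omegaZero₂ γ) (hwW : omegaZero₂ γ ≤ omegaInfty₁ γ) {P : ℝ × ℝ × ℝ}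
    (hP : P ∈ region α γ) : 0 < P.1 ∧ 0 < P.2.1 ∧ 0 < P.2.2 := by
  obtain ⟨δ, h0, h1, Q, hQ, rfl⟩ := exists_extrapolation hP (1, 1, 2)
  -- With zero decay this says only that Q is a convex combination of the vertices, so its
  -- coordinates are nonnegative; the share δ of (1, 1, 2) makes those of P positive.
  have hQ' : Attains (decay 0 0 0 0) 0 Q := by
    refine attains_of_mem_convexHull hα₀ hα₁ hw hwW ?_ ?_ ?_ ?_ ?_ ?_ ?_ hQ <;> simp
  obtain ⟨θ, hθ, -, rfl, -⟩ := hQ'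
  have h : ∀ c : Fin 7 → ℝ, (∀ i, 0 ≤ c i) → 0 ≤ ∑ i, θ i * c i :=
    fun c hc => Finset.sum_nonneg fun i _ => mul_nonneg (hθ i) (hc i)
  have hδ : 0 ≤ 1 - δ := by linarith
  refine ⟨?_, ?_, ?_⟩
  · have := mul_nonneg hδ (h (fun i => (vertex i).1) fun i => by fin_cases i <;> simp [vertex])
    simpa using by linarith
  · have := mul_nonneg hδ (h (fun i => (vertex i).2.1) fun i => by fin_cases i <;> simp [vertex])
    simpa using by linarith
  · have := mul_nonneg hδ (h (fun i => (vertex i).2.2) fun i => by fin_cases i <;> simp [vertex])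
    simpa using by linarith

/-! ### Consequences of the differential inequalities. -/

/-- A measurable curve with derivative `γ'` satisfying the differential inequalities of
`CurveHypothesis`, written without division. -/
structure IsCurve (γ γ' : ℝ → ℝ) (c C : ℝ) : Prop where
  measurable : Measurable γ
  hasDerivAt : ∀ t > 0, HasDerivAt γ (γ' t) t
  ne_zero : ∀ t > 0, γ t ≠ 0
  tendsto_deriv : Tendsto γ' (𝓝[>] 0) (𝓝 0)
  c_pos : 0 < c
  C_pos : 0 < C
  le_deriv : ∀ t > 0, c * |γ t| ≤ t * |γ' t|
  deriv_le : ∀ t > 0, t * |γ' t| ≤ C * |γ t|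
  second_deriv : ∃ γ'' : ℝ → ℝ, ∃ k > 0, ∀ t > 0,
    HasDerivAt γ' (γ'' t) t ∧ k * |γ t| ≤ t ^ 2 * |γ'' t|

theorem exists_Icc_of_abs_sub_le {E : Set ℝ} {f : ℝ → ℝ} {L : ℝ}
    (h : ∀ s ∈ E, ∀ t ∈ E, |f s - f t| ≤ L) : ∃ b, ∀ t ∈ E, f t ∈ Icc b (b + 2 * L) := by
  rcases E.eq_empty_or_nonempty with rfl | ⟨t₀, h₀⟩
  · exact ⟨0, fun t ht => ht.elim⟩
  · refine ⟨f t₀ - L, fun t ht => ?_⟩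
    have := abs_le.1 (h t ht t₀ h₀)
    exact ⟨by linarith [this.1], by linarith [this.2]⟩

theorem injOn_of_deriv_ne_zero {f f' : ℝ → ℝ} {E : Set ℝ} (hE : OrdConnected E)
    (hd : ∀ t ∈ E, HasDerivAt f (f' t) t) (hne : ∀ t ∈ E, f' t ≠ 0) : InjOn f E := by
  have key : ∀ s ∈ E, ∀ t ∈ E, s < t → f s ≠ f t := by
    intro s hs t ht hst heq
    have hsub : Icc s t ⊆ E := hE.out hs ht
    obtain ⟨u, hu, hu0⟩ := exists_hasDerivAt_eq_zero hst
      (fun x hx => (hd x (hsub hx)).continuousAt.continuousWithinAt) heq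
      (fun x hx => hd x (hsub (Ioo_subset_Icc_self hx)))
    exact hne u (hsub (Ioo_subset_Icc_self hu)) hu0
  intro s hs t ht heq
  rcases lt_trichotomy s t with h | h | h
  · exact absurd heq (key s hs t ht h)
  · exact h
  · exact absurd heq.symm (key t ht s hs h)

namespace IsCurve

variable {γ γ' : ℝ → ℝ} {c C : ℝ}

theorem deriv_ne_zero (h : IsCurve γ γ' c C) {t : ℝ} (ht : 0 < t) : γ' t ≠ 0 := by
  intro h0
  have := h.le_deriv t ht
  rw [h0, abs_zero, mul_zero] at this
  have h1 := mul_pos h.c_pos (abs_pos.2 (h.ne_zero t ht))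
  linarith

/-- The mean value inequality bounds distances within γ(E) by Mℓ, hence the condition 2Mℓ ≤ Λ. Since
`E` is an interval, Rolle's theorem gives injectivity of γ and γ - id. -/
theorem piece (h : IsCurve γ γ' c C) {E : Set ℝ} (hE : OrdConnected E) (hpos : ∀ t ∈ E, 0 < t)
    {ℓ m n Λ M : ℝ} (hℓ : ∃ a, E ⊆ Icc a (a + ℓ)) (hM : ∀ t ∈ E, |γ' t| ≤ M) (hM0 : 0 ≤ M)
    (hℓΛ : ℓ ≤ Λ) (hMΛ : 2 * (M * ℓ) ≤ Λ) (hm0 : 0 < m) (hn0 : 0 < n) (hΛ0 : 0 < Λ)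
    (hm : ∀ t ∈ E, m ≤ |γ' t|) (hn : ∀ t ∈ E, n ≤ |γ' t - 1|) : Piece γ γ' E ℓ m n Λ where
  measurableSet := hE.measurableSet
  subset_Icc := hℓ
  image_subset_Icc := by
    obtain ⟨a, ha⟩ := hℓ
    have hdist : ∀ s ∈ E, ∀ t ∈ E, |γ s - γ t| ≤ M * ℓ := by
      intro s hs t ht
      have := Convex.norm_image_sub_le_of_norm_hasDerivWithin_le (f := γ) (f' := γ') (s := E)
        (C := M) (x := t) (y := s) (fun x hx => (h.hasDerivAt x (hpos x hx)).hasDerivWithinAt)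
        (fun x hx => by simpa using hM x hx) hE.convex ht hs
      rw [Real.norm_eq_abs, Real.norm_eq_abs] at this
      refine this.trans (mul_le_mul_of_nonneg_left ?_ hM0)
      have h1 := ha hs
      have h2 := ha ht
      exact abs_le.2 ⟨by linarith [h1.1, h2.2], by linarith [h1.2, h2.1]⟩
    obtain ⟨b, hb⟩ := exists_Icc_of_abs_sub_le hdist
    exact ⟨b, fun t ht => ⟨(hb t ht).1, (hb t ht).2.trans (by linarith)⟩⟩
  length_le := hℓΛ
  pos_m := hm0
  pos_n := hn0
  pos_Λ := hΛ0
  hasDerivAt t ht := h.hasDerivAt t (hpos t ht)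
  m_le := hm
  n_le := hn
  injOn := injOn_of_deriv_ne_zero hE (fun t ht => h.hasDerivAt t (hpos t ht))
    fun t ht => h.deriv_ne_zero (hpos t ht)
  injOn_sub := injOn_of_deriv_ne_zero (f' := fun t => γ' t - 1) hE
    (fun t ht => (h.hasDerivAt t (hpos t ht)).sub (hasDerivAt_id t))
    fun t ht h0 => by
      have := hn t ht
      rw [h0, abs_zero] at this
      linarith

/-- The derivative γ'/γ of log|γ| is at most C/t in absolute value, so C log t ± log|γ(t)| are both
nondecreasing. -/
theorem abs_log_sub_log_le (h : IsCurve γ γ' c C) {s t : ℝ} (hs : 0 < s) (hst : s ≤ t) :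
    |Real.log (|γ t|) - Real.log (|γ s|)| ≤ C * (Real.log t - Real.log s) := by
  have hd : ∀ x > 0, HasDerivAt (fun x => Real.log (γ x)) (γ' x / γ x) x :=
    fun x hx => (h.hasDerivAt x hx).log (h.ne_zero x hx)
  have hlog : ∀ x > 0, HasDerivAt (fun x => C * Real.log x) (C * x⁻¹) x :=
    fun x hx => (Real.hasDerivAt_log hx.ne').const_mul C
  have hb : ∀ x > 0, |γ' x / γ x| ≤ C * x⁻¹ := by
    intro x hx
    rw [abs_div, div_le_iff₀ (abs_pos.2 (h.ne_zero x hx))]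
    have := h.deriv_le x hx
    calc |γ' x| = x⁻¹ * (x * |γ' x|) := by field_simp
      _ ≤ x⁻¹ * (C * |γ x|) := by gcongr
      _ = _ := by ring
  have hup : MonotoneOn (fun x => C * Real.log x - Real.log (γ x)) (Ioi 0) := by
    refine monotoneOn_of_hasDerivWithinAt_nonneg (convex_Ioi 0)
      (fun x hx => ((hlog x hx).sub (hd x hx)).continuousAt.continuousWithinAt)
      (fun x hx => ((hlog x (interior_subset hx)).sub
        (hd x (interior_subset hx))).hasDerivWithinAt) fun x hx => ?_
    have := (abs_le.1 (hb x (interior_subset hx))).2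
    linarith
  have hdown : MonotoneOn (fun x => C * Real.log x + Real.log (γ x)) (Ioi 0) := by
    refine monotoneOn_of_hasDerivWithinAt_nonneg (convex_Ioi 0)
      (fun x hx => ((hlog x hx).add (hd x hx)).continuousAt.continuousWithinAt)
      (fun x hx => ((hlog x (interior_subset hx)).add
        (hd x (interior_subset hx))).hasDerivWithinAt) fun x hx => ?_
    have := (abs_le.1 (hb x (interior_subset hx))).1
    linarith
  have h1 := hup hs (hs.trans_le hst) hst
  have h2 := hdown hs (hs.trans_le hst) hst
  simp only at h1 h2
  rw [Real.log_abs, Real.log_abs, abs_le]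
  constructor <;> linarith

theorem doubling (h : IsCurve γ γ' c C) {s t : ℝ} (hs : 0 < s) (hst : s ≤ t) (ht : t ≤ 2 * s) :
    |γ t| ≤ 2 ^ C * |γ s| ∧ |γ s| ≤ 2 ^ C * |γ t| := by
  have ht0 := hs.trans_le hst
  have hγs := abs_pos.2 (h.ne_zero s hs)
  have hγt := abs_pos.2 (h.ne_zero t ht0)
  have h1 := abs_le.1 (h.abs_log_sub_log_le hs hst)
  have h2 : Real.log t - Real.log s ≤ Real.log 2 := by
    have := Real.log_le_log ht0 ht
    rw [Real.log_mul (by norm_num) hs.ne'] at this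
    linarith
  have h3 : C * (Real.log t - Real.log s) ≤ C * Real.log 2 :=
    mul_le_mul_of_nonneg_left h2 h.C_pos.le
  have h4 : ∀ y : ℝ, 0 < y → Real.log (2 ^ C * y) = C * Real.log 2 + Real.log y := by
    intro y hy
    rw [Real.log_mul (by positivity) hy.ne', Real.log_rpow (by norm_num)]
  constructor
  · rw [← Real.log_le_log_iff hγt (by positivity), h4 _ hγs]
    linarith [h1.2]
  · rw [← Real.log_le_log_iff hγs (by positivity), h4 _ hγt]
    linarith [h1.1]

end IsCurve

/-! ### Dyadic pieces near 0 and near ∞. -/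

theorem rpow_le_of_comparable {x t : ℝ} (hx : 0 < x) (h1 : x ≤ 2 * t) (h2 : t ≤ 2 * x) (κ : ℝ) :
    t ^ κ ≤ 2 ^ |κ| * x ^ κ := by
  have ht : 0 < t := by linarith
  rw [← div_le_iff₀ (by positivity), ← Real.div_rpow ht.le hx.le]
  rcases le_total 0 κ with hκ | hκ
  · rw [abs_of_nonneg hκ]
    exact Real.rpow_le_rpow (by positivity) ((div_le_iff₀ hx).2 h2) hκ
  · rw [abs_of_nonpos hκ, ← inv_div, Real.inv_rpow (by positivity), ← Real.rpow_neg (by positivity)]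
    exact Real.rpow_le_rpow (by positivity) ((div_le_iff₀ ht).2 h1) (by linarith)

theorem le_rpow_of_comparable {x t : ℝ} (hx : 0 < x) (h1 : x ≤ 2 * t) (h2 : t ≤ 2 * x) (κ : ℝ) :
    x ^ κ / 2 ^ |κ| ≤ t ^ κ := by
  rw [div_le_iff₀ (by positivity), mul_comm]
  exact rpow_le_of_comparable (by linarith) h2 h1 κ

/-- `exists_hasBound_of_pieces` with a separate constant for each hypothesis. -/
theorem exists_hasBound_of_pieces_of_exists {γ γ' : ℝ → ℝ} (hγ : Measurable γ) {E : ℕ → Set ℝ}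
    {ℓ m n Λ : ℕ → ℝ} (hE : ∀ j, Piece γ γ' (E j) (ℓ j) (m j) (n j) (Λ j))
    {eℓ em en eΛ η α : ℝ}
    (hℓ : ∃ C : ℝ, ∀ j : ℕ, ℓ j ≤ C * 2 ^ (-(j * eℓ)))
    (hm : ∃ C : ℝ, ∀ j : ℕ, 1 / m j ≤ C * 2 ^ (-(j * em)))
    (hn : ∃ C : ℝ, ∀ j : ℕ, 1 / n j ≤ C * 2 ^ (-(j * en)))
    (hΛ : ∃ C : ℝ, ∀ j : ℕ, Λ j / n j ≤ C * 2 ^ (-(j * eΛ)))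
    {S : Set ℝ} (hS : S ⊆ ⋃ j, E j)
    (hη : ∃ C : ℝ, ∀ j : ℕ, ∀ t ∈ E j, t ^ (α - 1) ≤ C * 2 ^ (-(j * η)))
    {P : ℝ × ℝ × ℝ} {s : ℝ} (hP : Attains (decay eℓ em en eΛ) s P) (hs : 0 < s + η)
    (hP2 : 0 < P.2.2) : ∃ K : ℝ≥0∞, K ≠ ∞ ∧ HasBound γ (weighted α S) P K := by
  obtain ⟨C₁, h₁⟩ := hℓ
  obtain ⟨C₂, h₂⟩ := hm
  obtain ⟨C₃, h₃⟩ := hn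
  obtain ⟨C₄, h₄⟩ := hΛ
  obtain ⟨C₅, h₅⟩ := hη
  set D := 1 + |C₁| + |C₂| + |C₃| + |C₄| + |C₅| with hD
  have a₁ := abs_nonneg C₁
  have a₂ := abs_nonneg C₂
  have a₃ := abs_nonneg C₃
  have a₄ := abs_nonneg C₄
  have a₅ := abs_nonneg C₅
  have key : ∀ {A x y : ℝ}, x ≤ A * 2 ^ y → A ≤ D → x ≤ D * 2 ^ y := by
    intro A x y hx hA
    exact hx.trans (mul_le_mul_of_nonneg_right hA (by positivity))
  exact exists_hasBound_of_pieces hγ hE (C := D) (by linarith)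
    (fun j => key (h₁ j) (by linarith [le_abs_self C₁]))
    (fun j => key (h₂ j) (by linarith [le_abs_self C₂]))
    (fun j => key (h₃ j) (by linarith [le_abs_self C₃]))
    (fun j => key (h₄ j) (by linarith [le_abs_self C₄])) hS
    (fun j t ht => key (h₅ j t ht) (by linarith [le_abs_self C₅])) hP hs hP2

theorem mul_half_pow_rpow {x : ℝ} (hx : 0 < x) (j : ℕ) (κ : ℝ) :
    (x * (1 / 2) ^ j) ^ κ = x ^ κ * 2 ^ (-(j * κ)) := by
  rw [Real.mul_rpow hx.le (by positivity), one_div, inv_pow, Real.inv_rpow (by positivity),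
    ← Real.rpow_natCast, ← Real.rpow_mul (by norm_num), Real.rpow_neg (by norm_num)]

theorem mul_two_pow_rpow {x : ℝ} (hx : 0 < x) (j : ℕ) (κ : ℝ) :
    (x * 2 ^ j) ^ κ = x ^ κ * 2 ^ (-(j * -κ)) := by
  rw [Real.mul_rpow hx.le (by positivity), ← Real.rpow_natCast, ← Real.rpow_mul (by norm_num)]
  congr 2
  ring

namespace IsCurve

variable {γ γ' : ℝ → ℝ} {c C : ℝ}

theorem le_abs_deriv (h : IsCurve γ γ' c C) {t b : ℝ} (ht : 0 < t) (hb : t ^ b ≤ |γ t|) :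
    c * t ^ (b - 1) ≤ |γ' t| := by
  have h1 := h.le_deriv t ht
  rw [Real.rpow_sub_one ht.ne', mul_div_assoc', div_le_iff₀ ht, mul_comm |γ' t|]
  exact (mul_le_mul_of_nonneg_left hb h.c_pos.le).trans h1

/-- The part of the form near `t = 0`. -/
theorem exists_hasBound_near_zero (h : IsCurve γ γ' c C) {α b : ℝ}
    (hb : ∀ᶠ t in 𝓝[>] (0 : ℝ), t ^ b ≤ |γ t|) {P : ℝ × ℝ × ℝ} {s : ℝ}
    (hP : Attains (decay 1 (1 - b) 0 1) s P) (hs : 0 < s + (α - 1)) (hP2 : 0 < P.2.2) :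
    ∃ τ : ℝ, 0 < τ ∧ τ ≤ 1 ∧ ∃ K : ℝ≥0∞, K ≠ ∞ ∧ HasBound γ (weighted α (Ioc 0 τ)) P K := by
  have hsmall : ∀ᶠ t in 𝓝[>] (0 : ℝ), |γ' t| < 1 / 2 := by
    have := h.tendsto_deriv.abs
    rw [abs_zero] at this
    exact this.eventually_lt_const (by norm_num)
  obtain ⟨u, hu, hu'⟩ := mem_nhdsGT_iff_exists_Ioc_subset.1 (hb.and hsmall)
  have hu0 : (0 : ℝ) < u := hu
  set τ := min u 1 with hτ
  have hτ0 : 0 < τ := lt_min hu0 one_pos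
  have hgood : ∀ t, 0 < t → t ≤ τ → t ^ b ≤ |γ t| ∧ |γ' t| < 1 / 2 :=
    fun t h0 h1 => hu' ⟨h0, h1.trans (min_le_left _ _)⟩
  refine ⟨τ, hτ0, min_le_right _ _, ?_⟩
  set x : ℕ → ℝ := fun j => τ * (1 / 2) ^ j with hx
  have hx0 : ∀ j, 0 < x j := fun j => by positivity
  have hxτ : ∀ j, x j ≤ τ := fun j =>
    mul_le_of_le_one_right hτ0.le (pow_le_one₀ (by norm_num) (by norm_num))
  set E : ℕ → Set ℝ := fun j => Ioc (x j / 2) (x j) with hEdef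
  have hcmp : ∀ j, ∀ t ∈ E j, 0 < t ∧ x j ≤ 2 * t ∧ t ≤ 2 * x j ∧ t ≤ τ := by
    intro j t ht
    have := hx0 j
    have := hxτ j
    exact ⟨by linarith [ht.1], by linarith [ht.1], by linarith [ht.2], by linarith [ht.2]⟩
  have hc := h.c_pos
  -- Near 0, |γ'| < 1/2. So |γ' - 1| ≥ 1/2, and M = 1/2 allows Λ to equal the length bound `x j`.
  have hpiece : ∀ j, Piece γ γ' (E j) (x j) (c * (x j ^ (b - 1) / 2 ^ |b - 1|)) (1 / 2) (x j) := by
    intro j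
    have hj := hx0 j
    refine h.piece ordConnected_Ioc (fun t ht => (hcmp j t ht).1)
      ⟨0, fun t ht => ⟨(hcmp j t ht).1.le, by linarith [ht.2]⟩⟩ (M := 1 / 2)
      (fun t ht => ?_) (by norm_num) le_rfl (by linarith) (by positivity) (by norm_num) hj
      (fun t ht => ?_) (fun t ht => ?_)
    · obtain ⟨h0, h1, h2, h3⟩ := hcmp j t ht
      exact (hgood t h0 h3).2.le
    · obtain ⟨h0, h1, h2, h3⟩ := hcmp j t ht
      refine le_trans ?_ (h.le_abs_deriv h0 (hgood t h0 h3).1)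
      exact mul_le_mul_of_nonneg_left (le_rpow_of_comparable hj h1 h2 _) hc.le
    · obtain ⟨h0, h1, h2, h3⟩ := hcmp j t ht
      have := abs_lt.1 (hgood t h0 h3).2
      rw [abs_of_nonpos (by linarith)]
      linarith
  refine exists_hasBound_of_pieces_of_exists h.measurable hpiece (η := α - 1)
    ⟨τ, fun j => ?_⟩ ⟨2 ^ |b - 1| / c * τ ^ (1 - b), fun j => ?_⟩ ⟨2, fun j => ?_⟩
    ⟨2 * τ, fun j => ?_⟩ (fun t ht => ?_) ⟨2 ^ |α - 1| * τ ^ (α - 1), fun j t ht => ?_⟩ hP hs hP2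
  · have := mul_half_pow_rpow hτ0 j 1
    rw [Real.rpow_one, Real.rpow_one] at this
    exact this.le
  · refine le_of_eq ?_
    rw [mul_assoc, ← mul_half_pow_rpow hτ0 j, ← neg_sub b 1, Real.rpow_neg (hx0 j).le]
    have := Real.rpow_pos_of_pos (hx0 j) (b - 1)
    field_simp
  · norm_num
  · have := mul_half_pow_rpow hτ0 j 1
    rw [Real.rpow_one, Real.rpow_one] at this
    rw [mul_assoc, ← this]
    simp only [hx]
    linarith
  · obtain ⟨j, h1, h2⟩ := exists_nat_pow_near_of_lt_one (x := t / τ) (y := 1 / 2)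
      (div_pos ht.1 hτ0) ((div_le_one hτ0).2 ht.2) (by norm_num) (by norm_num)
    rw [lt_div_iff₀ hτ0] at h1
    rw [div_le_iff₀ hτ0] at h2
    refine mem_iUnion.2 ⟨j, ?_, ?_⟩
    · simp only [hx]
      rw [pow_succ] at h1
      linarith
    · simp only [hx]
      linarith
  · obtain ⟨h0, h1, h2, h3⟩ := hcmp j t ht
    rw [mul_assoc, ← mul_half_pow_rpow hτ0 j]
    exact rpow_le_of_comparable (hx0 j) h1 h2 _

/-- The part of the form near `t = ∞`. -/
theorem exists_hasBound_near_infty (h : IsCurve γ γ' c C) {α b : ℝ} (hb1 : 1 < b)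
    (hb : ∀ᶠ t in atTop, t ^ b ≤ |γ t|) {P : ℝ × ℝ × ℝ} {s : ℝ}
    (hP : Attains (decay (-1) (b - 1) (b - 1) (-1)) s P) (hs : 0 < s + (1 - α))
    (hP2 : 0 < P.2.2) :
    ∃ τ : ℝ, 1 ≤ τ ∧ ∃ K : ℝ≥0∞, K ≠ ∞ ∧ HasBound γ (weighted α (Ici τ)) P K := by
  have hc := h.c_pos
  have hC := h.C_pos
  have hlarge : ∀ᶠ t in atTop, 2 ≤ c * t ^ (b - 1) :=
    ((tendsto_rpow_atTop (by linarith : 0 < b - 1)).const_mul_atTop hc).eventually_ge_atTop 2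
  obtain ⟨u, hu⟩ := eventually_atTop.1 (hb.and hlarge)
  set τ := max u 1 with hτ
  have hτ1 : 1 ≤ τ := le_max_right _ _
  have hτ0 : 0 < τ := by linarith
  refine ⟨τ, hτ1, ?_⟩
  have hgood : ∀ t, τ ≤ t → t ^ b ≤ |γ t| ∧ 2 ≤ |γ' t| := by
    intro t ht
    have h1 := hu t ((le_max_left _ _).trans ht)
    exact ⟨h1.1, h1.2.trans (h.le_abs_deriv (by linarith) h1.1)⟩
  set x : ℕ → ℝ := fun j => τ * 2 ^ j with hx
  have hx0 : ∀ j, 0 < x j := fun j => by positivity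
  have hxτ : ∀ j, τ ≤ x j := fun j =>
    le_mul_of_one_le_right hτ0.le (one_le_pow₀ (by norm_num))
  -- By doubling, |γ'| is comparable to `B j` on the whole piece. Only a lower power bound for `B j`
  -- is at hand, and it suffices: Λ/n involves only the ratio M/m, from which `B j` cancels.
  set B : ℕ → ℝ := fun j => |γ (x j)| / x j with hB
  have hB0 : ∀ j, 0 < B j := fun j => div_pos (abs_pos.2 (h.ne_zero _ (hx0 j))) (hx0 j)
  have hBx : ∀ j, x j ^ (b - 1) ≤ B j := by
    intro j
    rw [Real.rpow_sub_one (hx0 j).ne']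
    exact div_le_div_of_nonneg_right (hgood _ (hxτ j)).1 (hx0 j).le
  set M : ℕ → ℝ := fun j => C * 2 ^ C * B j with hM
  set m : ℕ → ℝ := fun j => c / (2 * 2 ^ C) * B j with hm
  have hM0 : ∀ j, 0 < M j := fun j => mul_pos (by positivity) (hB0 j)
  have hm0 : ∀ j, 0 < m j := fun j => mul_pos (by positivity) (hB0 j)
  set E : ℕ → Set ℝ := fun j => Ico (x j) (2 * x j) with hEdef
  have hEτ : ∀ j, ∀ t ∈ E j, τ ≤ t := fun j t ht => (hxτ j).trans ht.1
  have hupper : ∀ j, ∀ t ∈ E j, |γ' t| ≤ M j := by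
    intro j t ht
    have ht0 : 0 < t := (hx0 j).trans_le ht.1
    have h1 := h.deriv_le t ht0
    have h2 := (h.doubling (hx0 j) ht.1 ht.2.le).1
    have h3 : x j * |γ' t| ≤ C * (2 ^ C * |γ (x j)|) :=
      (mul_le_mul_of_nonneg_right ht.1 (abs_nonneg _)).trans
        (h1.trans (mul_le_mul_of_nonneg_left h2 hC.le))
    simp only [hM, hB]
    rw [mul_div_assoc', le_div_iff₀ (hx0 j)]
    linarith
  have hlower : ∀ j, ∀ t ∈ E j, m j ≤ |γ' t| := by
    intro j t ht
    have ht0 : 0 < t := (hx0 j).trans_le ht.1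
    have h1 := h.le_deriv t ht0
    have h2 := (h.doubling (hx0 j) ht.1 ht.2.le).2
    have h3 : t * |γ' t| ≤ 2 * x j * |γ' t| :=
      mul_le_mul_of_nonneg_right ht.2.le (abs_nonneg _)
    have h4 : c * |γ (x j)| ≤ 2 ^ C * (2 * x j * |γ' t|) := by
      calc c * |γ (x j)| ≤ c * (2 ^ C * |γ t|) := mul_le_mul_of_nonneg_left h2 hc.le
        _ = 2 ^ C * (c * |γ t|) := by ring
        _ ≤ _ := mul_le_mul_of_nonneg_left (h1.trans h3) (by positivity)
    have := hx0 j
    simp only [hm, hB]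
    rw [div_mul_div_comm, div_le_iff₀ (by positivity)]
    linarith
  have hM2 : ∀ j, 2 ≤ M j := fun j =>
    (hgood _ (hxτ j)).2.trans (hupper j _ ⟨le_rfl, by linarith [hx0 j]⟩)
  -- Here |γ'| ≥ 2, hence |γ' - 1| ≥ |γ'|/2, which explains n = m/2.
  have hpiece : ∀ j, Piece γ γ' (E j) (x j) (m j) (m j / 2) (2 * (M j * x j)) := by
    intro j
    have hj := hx0 j
    have hMx : x j ≤ M j * x j := le_mul_of_one_le_left hj.le (by linarith [hM2 j])
    refine h.piece ordConnected_Ico (fun t ht => hj.trans_le ht.1)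
      ⟨x j, fun t ht => ⟨ht.1, by linarith [ht.2]⟩⟩ (hupper j) (hM0 j).le (by linarith) le_rfl
      (hm0 j) (half_pos (hm0 j)) (by linarith) (hlower j) fun t ht => ?_
    have h1 := hlower j t ht
    have h2 := (hgood t (hEτ j t ht)).2
    have h3 := abs_sub_abs_le_abs_sub (γ' t) 1
    rw [abs_one] at h3
    linarith
  have hxpow : ∀ j : ℕ, x j = τ * 2 ^ (-(j * (-1 : ℝ))) := by
    intro j
    have := mul_two_pow_rpow hτ0 j 1
    rwa [Real.rpow_one, Real.rpow_one] at this
  have hminv : ∀ j : ℕ, 1 / m j ≤ 2 * 2 ^ C / c * τ ^ (1 - b) * 2 ^ (-(j * (b - 1))) := by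
    intro j
    have h1 := mul_two_pow_rpow hτ0 j (1 - b)
    rw [neg_sub] at h1
    rw [mul_assoc, ← h1, ← neg_sub b 1, Real.rpow_neg (hx0 j).le]
    have h2 := Real.rpow_pos_of_pos (hx0 j) (b - 1)
    calc 1 / m j = 2 * 2 ^ C / c * (B j)⁻¹ := by
          simp only [hm]
          field_simp
      _ ≤ _ := mul_le_mul_of_nonneg_left (inv_anti₀ h2 (hBx j)) (by positivity)
  refine exists_hasBound_of_pieces_of_exists h.measurable hpiece (η := 1 - α)
    ⟨τ, fun j => (hxpow j).le⟩ ⟨_, hminv⟩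
    ⟨2 * (2 * 2 ^ C / c * τ ^ (1 - b)), fun j => ?_⟩
    ⟨4 * (C * 2 ^ C) / (c / (2 * 2 ^ C)) * τ, fun j => ?_⟩ (fun t ht => ?_)
    ⟨2 ^ |α - 1| * τ ^ (α - 1), fun j t ht => ?_⟩ hP hs hP2
  · rw [one_div_div, div_eq_mul_one_div, mul_assoc]
    exact mul_le_mul_of_nonneg_left (hminv j) (by norm_num)
  · rw [mul_assoc _ τ, ← hxpow]
    refine le_of_eq ?_
    have := hB0 j
    simp only [hM, hm]
    field_simp
    ring
  · obtain ⟨j, h1, h2⟩ := exists_nat_pow_near (x := t / τ) (y := 2)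
      ((one_le_div hτ0).2 ht) (by norm_num)
    rw [le_div_iff₀ hτ0] at h1
    rw [div_lt_iff₀ hτ0] at h2
    refine mem_iUnion.2 ⟨j, ?_, ?_⟩
    · simp only [hx]
      linarith
    · simp only [hx]
      rw [pow_succ] at h2
      linarith
  · have h1 := mul_two_pow_rpow hτ0 j (α - 1)
    rw [neg_sub] at h1
    rw [mul_assoc, ← h1]
    exact rpow_le_of_comparable (hx0 j) (by linarith [ht.1, hx0 j]) ht.2.le _

end IsCurve

/-! ### The middle range, where γ' may equal 1, and the union of the three ranges. -/

namespace IsCurve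

variable {γ γ' : ℝ → ℝ} {c C : ℝ}

theorem continuousOn_deriv (h : IsCurve γ γ' c C) : ContinuousOn γ' (Ioi 0) := by
  obtain ⟨γ'', k, -, hk⟩ := h.second_deriv
  exact fun t ht => (hk t ht).1.continuousAt.continuousWithinAt

theorem continuousOn (h : IsCurve γ γ' c C) : ContinuousOn γ (Ioi 0) :=
  fun t ht => (h.hasDerivAt t ht).continuousAt.continuousWithinAt

/-- On a compact interval the derivative of the curve is expanding, since the second derivative
does not vanish. -/
theorem exists_le_abs_deriv_sub (h : IsCurve γ γ' c C) {a b : ℝ} (ha : 0 < a) (hab : a ≤ b) :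
    ∃ κ > 0, ∀ s ∈ Icc a b, ∀ t ∈ Icc a b, κ * |s - t| ≤ |γ' s - γ' t| := by
  obtain ⟨γ'', k, hk0, hk⟩ := h.second_deriv
  have hpos : ∀ t ∈ Icc a b, 0 < t := fun t ht => ha.trans_le ht.1
  obtain ⟨z, hz, hzmin⟩ := isCompact_Icc.exists_isMinOn (nonempty_Icc.2 hab)
    (h.continuousOn.mono fun t ht => hpos t ht).abs
  have hγz : 0 < |γ z| := abs_pos.2 (h.ne_zero z (hpos z hz))
  have hb0 : 0 < b := ha.trans_le hab
  have hlow : ∀ t ∈ Icc a b, k * |γ z| / b ^ 2 ≤ |γ'' t| := by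
    intro t ht
    have ht0 := hpos t ht
    rw [div_le_iff₀ (by positivity)]
    calc k * |γ z| ≤ k * |γ t| := mul_le_mul_of_nonneg_left (hzmin ht) hk0.le
      _ ≤ t ^ 2 * |γ'' t| := (hk t ht0).2
      _ ≤ b ^ 2 * |γ'' t| := by
          have := ht.2
          gcongr
      _ = _ := mul_comm _ _
  refine ⟨k * |γ z| / b ^ 2, by positivity, ?_⟩
  have key : ∀ s ∈ Icc a b, ∀ t ∈ Icc a b, s < t →
      k * |γ z| / b ^ 2 * |s - t| ≤ |γ' s - γ' t| := by
    intro s hs t ht hst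
    have hsub : Icc s t ⊆ Icc a b := Icc_subset_Icc hs.1 ht.2
    obtain ⟨u, hu, hu'⟩ := exists_hasDerivAt_eq_slope γ' γ'' hst
      (fun x hx => (hk x (hpos x (hsub hx))).1.continuousAt.continuousWithinAt)
      (fun x hx => (hk x (hpos x (hsub (Ioo_subset_Icc_self hx)))).1)
    have h1 := hlow u (hsub (Ioo_subset_Icc_self hu))
    rw [hu', abs_div, le_div_iff₀ (abs_pos.2 (by linarith))] at h1
    rwa [abs_sub_comm s t, abs_sub_comm (γ' s)]
  intro s hs t ht
  rcases lt_trichotomy s t with hst | rfl | hst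
  · exact key s hs t ht hst
  · simp
  · rw [abs_sub_comm s t, abs_sub_comm (γ' s)]
    exact key t ht s hs hst

/-- The part of the form over a compact interval, on which `σ (γ' - 1)` is positive. -/
theorem exists_hasBound_middle (h : IsCurve γ γ' c C) {a b σ α : ℝ} (ha : 0 < a) (hab : a ≤ b)
    (hσ : |σ| = 1) (hα : α < 1) {P : ℝ × ℝ × ℝ} {s : ℝ} (hP : Attains (decay 1 0 (-1) 0) s P)
    (hs : 0 < s) (hP2 : 0 < P.2.2) :
    ∃ K : ℝ≥0∞, K ≠ ∞ ∧ HasBound γ (weighted α {t ∈ Icc a b | 0 < σ * (γ' t - 1)}) P K := by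
  have hpos : ∀ t ∈ Icc a b, 0 < t := fun t ht => ha.trans_le ht.1
  have hcont : ContinuousOn γ' (Icc a b) := h.continuousOn_deriv.mono fun t ht => hpos t ht
  obtain ⟨κ, hκ0, hκ⟩ := h.exists_le_abs_deriv_sub ha hab
  obtain ⟨z, hz, hzmin⟩ := isCompact_Icc.exists_isMinOn (nonempty_Icc.2 hab) hcont.abs
  obtain ⟨y, hy, hymax⟩ := isCompact_Icc.exists_isMaxOn (nonempty_Icc.2 hab) hcont.abs
  set m := |γ' z| with hm
  set M := |γ' y| with hM
  have hm0 : 0 < m := abs_pos.2 (h.deriv_ne_zero (hpos z hz))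
  have hmle : ∀ t ∈ Icc a b, m ≤ |γ' t| := fun t ht => hzmin ht
  have hMle : ∀ t ∈ Icc a b, |γ' t| ≤ M := fun t ht => hymax ht
  have hM0 : 0 ≤ M := abs_nonneg _
  set D := M + 1 with hD
  have hD0 : 0 < D := by linarith
  set ψ : ℝ → ℝ := fun t => σ * (γ' t - 1) with hψ
  have hψabs : ∀ t, |ψ t| = |γ' t - 1| := fun t => by rw [hψ, abs_mul, hσ, one_mul]
  have hψD : ∀ t ∈ Icc a b, ψ t ≤ D := by
    intro t ht
    refine (le_abs_self _).trans ?_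
    rw [hψabs]
    refine (abs_sub _ _).trans ?_
    rw [abs_one]
    linarith [hMle t ht]
  have hψsub : ∀ s ∈ Icc a b, ∀ t ∈ Icc a b, κ * |s - t| ≤ |ψ s - ψ t| := by
    intro s hs t ht
    have : ψ s - ψ t = σ * (γ' s - γ' t) := by simp only [hψ]; ring
    rw [this, abs_mul, hσ, one_mul]
    exact hκ s hs t ht
  -- The expanding bound makes the continuous ψ injective, hence strictly monotone; its dyadic level
  -- sets are then intervals.
  have hmono : StrictMonoOn ψ (Icc a b) ∨ StrictAntiOn ψ (Icc a b) := by
    refine ContinuousOn.strictMonoOn_of_injOn_Icc' hab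
      (continuousOn_const.mul (hcont.sub continuousOn_const)) ?_
    intro s hs t ht hst
    have h1 := hψsub s hs t ht
    rw [hst, sub_self, abs_zero] at h1
    have h2 : |s - t| ≤ 0 := by
      by_contra h3
      linarith [mul_pos hκ0 (not_le.1 h3)]
    exact sub_eq_zero.1 (abs_eq_zero.1 (le_antisymm h2 (abs_nonneg _)))
  set E : ℕ → Set ℝ := fun j =>
    {t ∈ Icc a b | ψ t ∈ Ioc (D * (1 / 2) ^ (j + 1)) (D * (1 / 2) ^ j)} with hE
  have hord : ∀ j, OrdConnected (E j) := by
    refine fun j => ⟨fun s hs t ht u hu => ?_⟩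
    have hu' : u ∈ Icc a b := ⟨hs.1.1.trans hu.1, hu.2.trans ht.1.2⟩
    refine ⟨hu', ?_⟩
    rcases hmono with hmono | hmono
    · exact ⟨hs.2.1.trans_le (hmono.monotoneOn hs.1 hu' hu.1),
        (hmono.monotoneOn hu' ht.1 hu.2).trans ht.2.2⟩
    · exact ⟨ht.2.1.trans_le (hmono.antitoneOn hu' ht.1 hu.2),
        (hmono.antitoneOn hs.1 hu' hu.1).trans hs.2.2⟩
  set ℓ : ℕ → ℝ := fun j => 2 * (D * (1 / 2) ^ j / κ) with hℓ
  have hℓ0 : ∀ j, 0 < ℓ j := fun j => by positivity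
  -- ψ varies by at most D·2^{-j} on the level set and expands distances by κ. Length and n thus
  -- both scale like 2^{-j}, so Λ/n stays bounded.
  have hlen : ∀ j, ∃ x, E j ⊆ Icc x (x + ℓ j) := by
    intro j
    refine exists_Icc_of_abs_sub_le (f := fun t => t) fun s hs t ht => ?_
    rw [le_div_iff₀ hκ0, mul_comm]
    refine (hψsub s hs.1 t ht.1).trans ?_
    have h0 : 0 < D * (1 / 2) ^ (j + 1) := by positivity
    exact abs_le.2 ⟨by linarith [hs.2.1, ht.2.2], by linarith [hs.2.2, ht.2.1]⟩
  have hpiece : ∀ j, Piece γ γ' (E j) (ℓ j) m (D * (1 / 2) ^ (j + 1)) ((1 + 2 * M) * ℓ j) := by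
    intro j
    have hj := hℓ0 j
    have hMj : 0 ≤ M * ℓ j := mul_nonneg hM0 hj.le
    refine h.piece (hord j) (fun t ht => hpos t ht.1) (hlen j) (fun t ht => hMle t ht.1) hM0
      (by linarith) (by linarith) hm0 (by positivity) (by positivity) (fun t ht => hmle t ht.1)
      fun t ht => ?_
    rw [← hψabs]
    exact ht.2.1.le.trans (le_abs_self _)
  have hhalf : ∀ j : ℕ, ((1 : ℝ) / 2) ^ j = 2 ^ (-(j * (1 : ℝ))) := by
    intro j
    simp
  refine exists_hasBound_of_pieces_of_exists h.measurable hpiece (η := 0)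
    ⟨2 * (D / κ), fun j => ?_⟩ ⟨1 / m, fun j => ?_⟩ ⟨2 / D, fun j => ?_⟩
    ⟨(1 + 2 * M) * 4 / κ, fun j => ?_⟩ (fun t ht => ?_) ⟨a ^ (α - 1), fun j t ht => ?_⟩ hP
    (by linarith) hP2
  · rw [← hhalf]
    refine le_of_eq ?_
    simp only [hℓ]
    ring
  · simp
  · refine le_of_eq ?_
    rw [show -((j : ℝ) * -1) = -(-(j * 1)) by ring, Real.rpow_neg (by norm_num), ← hhalf, pow_succ]
    field_simp
  · refine le_of_eq ?_
    rw [mul_zero, neg_zero, Real.rpow_zero, mul_one]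
    simp only [hℓ]
    rw [pow_succ]
    field_simp
    ring
  · obtain ⟨j, h1, h2⟩ := exists_nat_pow_near_of_lt_one (x := ψ t / D) (y := 1 / 2)
      (div_pos ht.2 hD0) ((div_le_one hD0).2 (hψD t ht.1)) (by norm_num) (by norm_num)
    rw [lt_div_iff₀ hD0, mul_comm] at h1
    rw [div_le_iff₀ hD0, mul_comm] at h2
    exact mem_iUnion.2 ⟨j, ht.1, h1, h2⟩
  · rw [mul_zero, neg_zero, Real.rpow_zero, mul_one]
    exact Real.rpow_le_rpow_of_nonpos ha ht.1.1 (by linarith)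

/-- The three parts of the form together. -/
theorem exists_hasBound (h : IsCurve γ γ' c C) {α b₀ b₁ s₀ s₁ s : ℝ} (hα : α < 1) (hb1 : 1 < b₁)
    (hb₀ : ∀ᶠ t in 𝓝[>] (0 : ℝ), t ^ b₀ ≤ |γ t|) (hb₁ : ∀ᶠ t in atTop, t ^ b₁ ≤ |γ t|)
    {P : ℝ × ℝ × ℝ} (hP2 : 0 < P.2.2)
    (hP₀ : Attains (decay 1 (1 - b₀) 0 1) s₀ P) (hs₀ : 0 < s₀ + (α - 1))
    (hP₁ : Attains (decay (-1) (b₁ - 1) (b₁ - 1) (-1)) s₁ P) (hs₁ : 0 < s₁ + (1 - α))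
    (hP : Attains (decay 1 0 (-1) 0) s P) (hs : 0 < s) :
    ∃ K : ℝ≥0∞, K ≠ ∞ ∧ HasBound γ (weighted α (Ioi 0)) P K := by
  obtain ⟨τ₀, hτ₀, hτ₀', hzero⟩ := h.exists_hasBound_near_zero hb₀ hP₀ hs₀ hP2
  obtain ⟨τ₁, hτ₁, hinfty⟩ := h.exists_hasBound_near_infty hb1 hb₁ hP₁ hs₁ hP2
  have hab : τ₀ ≤ τ₁ := hτ₀'.trans hτ₁
  have hplus := h.exists_hasBound_middle (σ := 1) hτ₀ hab (by simp) hα hP hs hP2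
  have hminus := h.exists_hasBound_middle (σ := -1) hτ₀ hab (by simp) hα hP hs hP2
  have hγ := h.measurable
  obtain ⟨K, hK, hb⟩ := exists_hasBound_union hγ hP2 (exists_hasBound_union hγ hP2 hzero hinfty)
    (exists_hasBound_union hγ hP2 hplus hminus)
  refine ⟨K, hK, hb.mono_measure (weighted_mono_ae ?_)⟩
  -- The expanding bound allows γ' = 1 at no more than one point.
  have hnull : volume {t ∈ Icc τ₀ τ₁ | γ' t = 1} = 0 := by
    refine Set.Subsingleton.measure_zero (fun s hs t ht => ?_) _
    obtain ⟨κ, hκ0, hκ⟩ := h.exists_le_abs_deriv_sub hτ₀ hab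
    have h1 := hκ s hs.1 t ht.1
    rw [hs.2, ht.2, sub_self, abs_zero] at h1
    have h2 : |s - t| ≤ 0 := by
      by_contra h3
      linarith [mul_pos hκ0 (not_le.1 h3)]
    exact sub_eq_zero.1 (abs_eq_zero.1 (le_antisymm h2 (abs_nonneg _)))
  filter_upwards [measure_eq_zero_iff_ae_notMem.1 hnull] with t ht ht0
  rcases le_or_gt t τ₀ with h1 | h1
  · exact Or.inl (Or.inl ⟨ht0, h1⟩)
  rcases le_or_gt τ₁ t with h2 | h2
  · exact Or.inl (Or.inr h2)
  have htI : t ∈ Icc τ₀ τ₁ := ⟨h1.le, h2.le⟩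
  rcases lt_trichotomy (γ' t) 1 with h3 | h3 | h3
  · exact Or.inr (Or.inr ⟨htI, by linarith⟩)
  · exact absurd ⟨htI, h3⟩ ht
  · exact Or.inr (Or.inl ⟨htI, by linarith⟩)

end IsCurve

/-! ### Orders of growth and the choice of exponents. -/

namespace IsCurve

variable {γ γ' : ℝ → ℝ} {c C : ℝ}

/-- The quotient of logarithms is bounded away from `t = 1`. -/
theorem abs_log_div_log_le (h : IsCurve γ γ' c C) {t : ℝ} (ht : 0 < t) (hlog : 1 ≤ |Real.log t|) :
    |Real.log (|γ t|) / Real.log t| ≤ |Real.log (|γ 1|)| + C := by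
  have hpos : 0 < |Real.log t| := by linarith
  have key : |Real.log (|γ t|) - Real.log (|γ 1|)| ≤ C * |Real.log t| := by
    rcases le_total 1 t with h1 | h1
    · have := h.abs_log_sub_log_le one_pos h1
      rwa [Real.log_one, sub_zero, ← abs_of_nonneg (Real.log_nonneg h1)] at this
    · have := h.abs_log_sub_log_le ht h1
      rwa [Real.log_one, zero_sub, ← abs_of_nonpos (Real.log_nonpos ht.le h1), abs_sub_comm]
        at this
  rw [abs_div, div_le_iff₀ hpos]
  have h2 := abs_sub_abs_le_abs_sub (Real.log (|γ t|)) (Real.log (|γ 1|))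
  have h3 : |Real.log (|γ 1|)| ≤ |Real.log (|γ 1|)| * |Real.log t| :=
    le_mul_of_one_le_right (abs_nonneg _) hlog
  rw [add_mul]
  linarith

theorem eventually_bounded_infty (h : IsCurve γ γ' c C) :
    ∀ᶠ t in atTop, |Real.log (|γ t|) / Real.log t| ≤ |Real.log (|γ 1|)| + C := by
  filter_upwards [eventually_gt_atTop 0, Real.tendsto_log_atTop.eventually_ge_atTop 1]
    with t ht hlog
  exact h.abs_log_div_log_le ht (hlog.trans (le_abs_self _))

theorem eventually_bounded_zero (h : IsCurve γ γ' c C) :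
    ∀ᶠ t in 𝓝[>] (0 : ℝ), |Real.log (|γ t|) / Real.log t| ≤ |Real.log (|γ 1|)| + C := by
  filter_upwards [self_mem_nhdsWithin,
    Real.tendsto_log_nhdsGT_zero.eventually_le_atBot (-1)] with t ht hlog
  exact h.abs_log_div_log_le ht (by linarith [neg_le_abs (Real.log t)])

theorem eventually_rpow_le_infty (h : IsCurve γ γ' c C) {b : ℝ} (hb : b < omegaInfty₁ γ) :
    ∀ᶠ t in atTop, t ^ b ≤ |γ t| := by
  have hbdd : IsBoundedUnder (· ≥ ·) atTop fun t : ℝ => Real.log |γ t| / Real.log t :=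
    ⟨_, eventually_map.2 (h.eventually_bounded_infty.mono fun t ht => (abs_le.1 ht).1)⟩
  filter_upwards [eventually_lt_of_lt_liminf hb hbdd, eventually_gt_atTop 1] with t hlt ht
  have ht0 : 0 < t := by linarith
  rw [← Real.log_le_log_iff (by positivity) (abs_pos.2 (h.ne_zero t ht0)), Real.log_rpow ht0]
  exact ((lt_div_iff₀ (Real.log_pos ht)).1 hlt).le

/-- Because log t < 0 near 0, an upper bound on the quotient of logarithms is a lower bound on |γ|;
hence the limsup governs here and the liminf at ∞. -/
theorem eventually_rpow_le_zero (h : IsCurve γ γ' c C) {b : ℝ} (hb : omegaZero₂ γ < b) :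
    ∀ᶠ t in 𝓝[>] (0 : ℝ), t ^ b ≤ |γ t| := by
  have hbdd : IsBoundedUnder (· ≤ ·) (𝓝[>] (0 : ℝ)) fun t : ℝ => Real.log |γ t| / Real.log t :=
    ⟨_, eventually_map.2 (h.eventually_bounded_zero.mono fun t ht => (abs_le.1 ht).2)⟩
  filter_upwards [eventually_lt_of_limsup_lt hb hbdd, Ioo_mem_nhdsGT (one_pos : (0 : ℝ) < 1)]
    with t hlt ht
  rw [← Real.log_le_log_iff (Real.rpow_pos_of_pos ht.1 b) (abs_pos.2 (h.ne_zero t ht.1)),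
    Real.log_rpow ht.1]
  exact ((div_lt_iff_of_neg (Real.log_neg ht.1 ht.2)).1 hlt).le

theorem omegaZero₁_le (h : IsCurve γ γ' c C) : omegaZero₁ γ ≤ omegaZero₂ γ :=
  liminf_le_limsup
    ⟨_, eventually_map.2 (h.eventually_bounded_zero.mono fun _ ht => (abs_le.1 ht).2)⟩
    ⟨_, eventually_map.2 (h.eventually_bounded_zero.mono fun _ ht => (abs_le.1 ht).1)⟩

/-- The form is bounded at every point of the region. -/
theorem exists_hasBound_of_mem_region (h : IsCurve γ γ' c C) {α : ℝ} (hα₀ : 0 < α) (hα₁ : α < 1)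
    (hw : 1 < omegaZero₁ γ) (hwW : omegaZero₂ γ ≤ omegaInfty₁ γ)
    (hα : omegaInfty₁ γ ≤ α / (1 - α)) {P : ℝ × ℝ × ℝ} (hP : P ∈ region α γ) :
    ∃ K : ℝ≥0∞, K ≠ ∞ ∧ HasBound γ (weighted α (Ioi 0)) P K := by
  have hw₂ : 1 < omegaZero₂ γ := hw.trans_le h.omegaZero₁_le
  have hP2 := (pos_of_mem_region hα₀ hα₁ hw₂ hwW hP).2.2
  -- The vertex (0, 0, 0) has decay 1 near 0 and in the middle range, above the critical values 1 -
  -- α and 0. Near ∞ the vertex (0, 1, 0), with decay b - 1 > 0, exceeds the critical value α - 1.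
  obtain ⟨δ₀, hδ₀, hδ₀', Q₀, hQ₀, hPQ₀⟩ := exists_extrapolation hP (vertex 0)
  obtain ⟨δ₁, hδ₁, hδ₁', Q₁, hQ₁, hPQ₁⟩ := exists_extrapolation hP (vertex 2)
  have hB₀ := fun b (hb : omegaZero₂ γ < b) => h.eventually_rpow_le_zero hb
  have hB₁ := fun b (hb : b < omegaInfty₁ γ) => h.eventually_rpow_le_infty hb
  have hhull := fun {eℓ em en eΛ s : ℝ} => attains_of_mem_convexHull (α := α) (γ := γ)
    (eℓ := eℓ) (em := em) (en := en) (eΛ := eΛ) (s := s) hα₀ hα₁ hw₂ hwW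
  generalize omegaInfty₁ γ = W at *
  generalize omegaZero₂ γ = w at *
  have hW : 1 < W := hw₂.trans_le hwW
  -- This is what (1, 1/2, 1) needs near 0: it attains 1/2 there, to be compared with 1 - α.
  have hhalf : 1 / 2 < α := by
    have h1 : 1 < α / (1 - α) := hW.trans_le hα
    rw [one_lt_div (by linarith)] at h1
    linarith
  have hκ : ∀ ω, 1 < ω → 0 < α / ω ∧ α / ω ≤ 1 ∧ α / ω * ω = α ∧ α / ω ≤ α := by
    intro ω hω
    have : 0 < ω := by linarith
    exact ⟨by positivity, (div_le_one this).2 (by linarith), div_mul_cancel₀ _ this.ne',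
      div_le_self hα₀.le hω.le⟩
  obtain ⟨hκW0, hκW1, hκWW, hκWα⟩ := hκ W hW
  obtain ⟨hκw0, hκw1, hκww, hκwα⟩ := hκ w hw₂
  set κ := α / W
  set κ' := α / w
  -- Taking b = w + ε₀ near 0 costs at most ε₀, while the extrapolation gains δ₀(1 - (1 - α)) = δ₀α,
  -- up to a term of favourable sign.
  set ε₀ := δ₀ * α / 2 with hε₀
  have hε₀0 : 0 < ε₀ := by positivity
  -- Taking b = W - ε₁ near ∞ costs ε₁ and the extrapolation gains δ₁(W - α); the second entry of
  -- the minimum ensures b > 1.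
  set ε₁ := min (δ₁ * (W - α) / 2) ((W - 1) / 2) with hε₁
  have hWα : 0 < δ₁ * (W - α) := mul_pos hδ₁ (by linarith)
  have hε₁0 : 0 < ε₁ := lt_min (by linarith) (by linarith)
  have hε₁a : ε₁ ≤ δ₁ * (W - α) / 2 := min_le_left _ _
  have hε₁b : ε₁ ≤ (W - 1) / 2 := min_le_right _ _
  have hκε₀ : κ * ε₀ ≤ ε₀ := mul_le_of_le_one_left hε₀0.le hκW1
  have hκ'ε₀ : κ' * ε₀ ≤ ε₀ := mul_le_of_le_one_left hε₀0.le hκw1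
  have hκε₁ : κ * ε₁ ≤ ε₁ := mul_le_of_le_one_left hε₁0.le hκW1
  have hκ'ε₁ : κ' * ε₁ ≤ ε₁ := mul_le_of_le_one_left hε₁0.le hκw1
  have hκw : κ * w ≤ κ * W := mul_le_mul_of_nonneg_left hwW hκW0.le
  have hκ'w : κ' * w ≤ κ' * W := mul_le_mul_of_nonneg_left hwW hκw0.le
  have hG : W ≤ 2 * α → 1 - α ≤ (1 - α) / (2 - W) ∧ (1 - α) / (2 - W) ≤ 1 ∧
      (1 - α) / (2 - W) * (2 - W) = 1 - α := by
    intro h2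
    have h3 : 0 < 2 - W := by linarith
    refine ⟨?_, (div_le_one h3).2 (by linarith), div_mul_cancel₀ _ h3.ne'⟩
    rw [le_div_iff₀ h3]
    exact mul_le_of_le_one_right (by linarith) (by linarith)
  have hzero : Attains (decay 1 (1 - (w + ε₀)) 0 1)
      ((1 - δ₀) * (1 - α - ε₀) + δ₀ * 1) P := by
    refine attains_of_extrapolation hδ₀ hδ₀' hPQ₀ (hhull ?_ ?_ ?_ ?_ ?_ ?_ ?_ hQ₀) le_rfl
    · linarith
    · linarith
    · linarith
    · linarith
    · intro h2
      linarith [(hG h2).1]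
    · intro _
      linarith
    · intro _
      linarith
  have hinfty : Attains (decay (-1) (W - ε₁ - 1) (W - ε₁ - 1) (-1))
      ((1 - δ₁) * (α - 1 - ε₁) + δ₁ * (W - ε₁ - 1)) P := by
    refine attains_of_extrapolation hδ₁ hδ₁' hPQ₁ (hhull ?_ ?_ ?_ ?_ ?_ ?_ ?_ hQ₁) le_rfl
    · linarith
    · linarith
    · linarith
    · linarith
    · intro h2
      obtain ⟨h3, h4, h5⟩ := hG h2
      have : (1 - α) / (2 - W) * ε₁ ≤ ε₁ := mul_le_of_le_one_left hε₁0.le h4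
      linarith
    · intro _
      linarith
    · intro h2
      linarith
  have hmiddle : Attains (decay 1 0 (-1) 0) ((1 - δ₀) * 0 + δ₀ * 1) P := by
    refine attains_of_extrapolation hδ₀ hδ₀' hPQ₀ (hhull ?_ ?_ ?_ ?_ ?_ ?_ ?_ hQ₀) le_rfl
    · linarith
    · linarith
    · linarith
    · linarith
    · intro _
      simp
    · intro h2
      -- At (1, κ, 1) the loss from n ~ 2^{-j} has weight κ and the gain from the length has weight
      -- 1 - κ. The case 2α < W is precisely κ < 1/2.
      have : κ * W < 1 / 2 * W := by linarith
      have : κ < 1 / 2 := lt_of_mul_lt_mul_right this (by linarith)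
      linarith
    · intro _
      linarith
  have hδε₀ : 0 < δ₀ * ε₀ := by positivity
  refine h.exists_hasBound hα₁ (by linarith) (hB₀ (w + ε₀) (by linarith))
    (hB₁ (W - ε₁) (by linarith)) hP2 hzero ?_ hinfty ?_ hmiddle (by linarith)
  · linarith [mul_pos hδ₀ hα₀]
  · linarith

end IsCurve

/-! ### From the positive form to the operator. -/

/-- Extending γ by 0 to t ≤ 0 makes it measurable on the whole line, without changing γ or its
derivative at any t > 0. -/
theorem CurveHypothesis.exists_isCurve {γ : ℝ → ℝ} (hγ : CurveHypothesis γ) :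
    ∃ c C, IsCurve ((Ioi 0).indicator γ) (deriv γ) c C := by
  obtain ⟨c, hc, C, hC, h1⟩ := hγ.first_deriv
  obtain ⟨k, hk, h2⟩ := hγ.second_deriv
  have heq : ∀ t > 0, (Ioi 0).indicator γ t = γ t := fun t ht => indicator_of_mem (mem_Ioi.2 ht) γ
  have hne : ∀ t > 0, γ t ≠ 0 := by
    intro t ht h0
    have := (h1 t ht).1
    rw [h0, div_zero, abs_zero] at this
    linarith
  have habs : ∀ t > 0, |t * deriv γ t / γ t| = t * |deriv γ t| / |γ t| := by
    intro t ht
    rw [abs_div, abs_mul, abs_of_pos ht]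
  refine ⟨c, C, ?_, ?_, ?_, hγ.tendsto_deriv_zero, hc, hC, ?_, ?_, ?_⟩
  · classical
    rw [← piecewise_eq_indicator]
    exact hγ.contDiffOn.continuousOn.measurable_piecewise continuousOn_const measurableSet_Ioi
  · intro t ht
    have hd : DifferentiableAt ℝ γ t :=
      (hγ.contDiffOn.contDiffAt (Ioi_mem_nhds ht)).differentiableAt (by norm_num)
    refine hd.hasDerivAt.congr_of_eventuallyEq ?_
    filter_upwards [Ioi_mem_nhds ht] with s hs using heq s hs
  · intro t ht
    rw [heq t ht]
    exact hne t ht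
  · intro t ht
    rw [heq t ht]
    have := (h1 t ht).1
    rwa [habs t ht, le_div_iff₀ (abs_pos.2 (hne t ht))] at this
  · intro t ht
    rw [heq t ht]
    have := (h1 t ht).2
    rwa [habs t ht, div_le_iff₀ (abs_pos.2 (hne t ht))] at this
  · refine ⟨iteratedDeriv 2 γ, k, hk, fun t ht => ⟨?_, ?_⟩⟩
    · have hd : ContDiffOn ℝ 1 (deriv γ) (Ioi 0) :=
        hγ.contDiffOn.deriv_of_isOpen isOpen_Ioi (by norm_num)
      have := ((hd.contDiffAt (Ioi_mem_nhds ht)).differentiableAt (by norm_num)).hasDerivAt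
      rwa [iteratedDeriv_succ, iteratedDeriv_one]
    · rw [heq t ht]
      have := h2 t ht
      rwa [abs_div, abs_mul, abs_of_pos (pow_pos ht 2), le_div_iff₀ (abs_pos.2 (hne t ht))] at this

/-- For f, the reflection t ↦ x - t preserves null sets for every x. For g, Tonelli is used instead:
at fixed t the map x ↦ x - γ(t) is a translation, so almost every x misses the exceptional set for
almost every t. -/
theorem ae_integrand_congr {γ : ℝ → ℝ} (hγ : Measurable γ) (α : ℝ) {f f₀ g g₀ : ℝ → ℂ}
    (hf : f =ᵐ[volume] f₀) (hg : g =ᵐ[volume] g₀) :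
    ∀ᵐ x : ℝ, integrand α γ f g x =ᵐ[volume.restrict (Ioi 0)] integrand α γ f₀ g₀ x := by
  set N := toMeasurable volume {y | ¬ g y = g₀ y} with hN
  have hN0 : volume N = 0 := by rw [hN, measure_toMeasurable]; exact hg
  have hNg : ∀ y, y ∉ N → g y = g₀ y := by
    intro y hy
    by_contra h
    exact hy (subset_toMeasurable _ _ h)
  have hswap : ∀ᵐ x : ℝ, ∀ᵐ t : ℝ, x - γ t ∈ Nᶜ := by
    refine (Measure.ae_ae_comm (p := fun x t : ℝ => x - γ t ∈ Nᶜ) ?_).2 (ae_of_all _ fun t => ?_)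
    · exact (measurable_fst.sub (hγ.comp measurable_snd)) (measurableSet_toMeasurable _ _).compl
    · exact (measurePreserving_sub_right volume (γ t)).quasiMeasurePreserving.ae
        (measure_eq_zero_iff_ae_notMem.1 hN0)
  filter_upwards [hswap] with x hx
  refine ae_restrict_of_ae ?_
  filter_upwards [hx, (quasiMeasurePreserving_sub_left volume x).ae hf]
    with t h1 h2
  rw [integrand, integrand, hNg _ h1, h2]

theorem enorm_integrand (α : ℝ) (γ : ℝ → ℝ) (f g : ℝ → ℂ) (x : ℝ) {t : ℝ} (ht : 0 < t) :
    ‖integrand α γ f g x t‖ₑ =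
      ENNReal.ofReal (t ^ (α - 1)) * (‖f (x - t)‖ₑ * ‖g (x - γ t)‖ₑ) := by
  rw [integrand, div_eq_mul_inv, ← Complex.ofReal_inv, ← Real.rpow_neg ht.le, neg_sub, enorm_mul,
    enorm_mul, mul_comm]
  congr 1
  rw [← ofReal_norm, Complex.norm_real, Real.norm_of_nonneg (by positivity)]

/-- The bound for strongly measurable functions. -/
theorem bilinearFractional_bound_of_stronglyMeasurable {γ : ℝ → ℝ} (hγ : Measurable γ)
    {α p q r : ℝ} (hp : 0 < p) (hq : 0 < q) (hr : 0 < r) {K : ℝ≥0∞} (hK : K ≠ ∞)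
    (hb : HasBound γ (weighted α (Ioi 0)) (1 / p, 1 / q, 1 / r) K) {f g : ℝ → ℂ}
    (hfm : StronglyMeasurable f) (hgm : StronglyMeasurable g)
    (hf : MemLp f (ENNReal.ofReal p) volume) (hg : MemLp g (ENNReal.ofReal q) volume) :
    (∀ᵐ x : ℝ, IntegrableOn (integrand α γ f g x) (Ioi 0) volume) ∧
      AEStronglyMeasurable (bilinearFractional α γ f g) volume ∧
      eLpNorm (bilinearFractional α γ f g) (ENNReal.ofReal r) volume ≤
        K * eLpNorm f (ENNReal.ofReal p) volume * eLpNorm g (ENNReal.ofReal q) volume := by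
  have hnorm : ∀ {a : ℝ} (_ : 0 < a) (k : ℝ → ℂ), eLpNorm k (ENNReal.ofReal a) volume =
      (∫⁻ y, ‖k y‖ₑ ^ a) ^ (1 / a) := by
    intro a ha k
    rw [eLpNorm_eq_lintegral_rpow_enorm_toReal (by simpa using ha) ENNReal.ofReal_ne_top,
      ENNReal.toReal_ofReal ha.le]
  have hroot : ∀ {a : ℝ} (_ : 0 < a) (y : ℝ≥0∞), (y ^ a) ^ (1 / a) = y := by
    intro a ha y
    rw [← ENNReal.rpow_mul, mul_one_div_cancel ha.ne', ENNReal.rpow_one]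
  have hfe : Measurable fun y => ‖f y‖ₑ := hfm.measurable.enorm
  have hge : Measurable fun y => ‖g y‖ₑ := hgm.measurable.enorm
  set M : ℝ → ℝ≥0∞ := posForm γ (weighted α (Ioi 0)) (fun y => ‖f y‖ₑ) fun y => ‖g y‖ₑ with hM
  have hsf : SFinite (weighted α (Ioi 0)) := by
    unfold weighted
    infer_instance
  have hMm : Measurable M := measurable_posForm hγ _ hfe hge
  have hMint : ∀ x, ∫⁻ t in Ioi 0, ‖integrand α γ f g x t‖ₑ = M x := by
    intro x
    simp only [hM, posForm, weighted]
    have hweight : Measurable fun t : ℝ => ENNReal.ofReal (t ^ (α - 1)) := by fun_prop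
    have hslice : Measurable fun t => ‖f (x - t)‖ₑ * ‖g (x - γ t)‖ₑ :=
      (measurable_posForm_integrand hγ hfe hge).comp measurable_prodMk_left
    rw [lintegral_withDensity_eq_lintegral_mul _ hweight hslice]
    exact setLIntegral_congr_fun measurableSet_Ioi fun t ht => enorm_integrand α γ f g x ht
  have hbound : ∫⁻ x, M x ^ r ≤ (K * eLpNorm f (ENNReal.ofReal p) volume *
      eLpNorm g (ENNReal.ofReal q) volume) ^ r := by
    -- With F = |f|^p and G = |g|^q the powers 1/p and 1/q in `HasBound` return |f| and |g|.
    rcases hb (fun y => ‖f y‖ₑ ^ p) (fun y => ‖g y‖ₑ ^ q) (hfe.pow_const _) (hge.pow_const _)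
      with h0 | h0
    · exact absurd h0.1 (one_div_pos.2 hr).ne'
    · have := h0.2
      simp only [hroot hp, hroot hq, one_div_one_div] at this
      rw [hnorm hp, hnorm hq]
      exact this
  have hfin : ∫⁻ x, M x ^ r ≠ ∞ := by
    refine (hbound.trans_lt (ENNReal.rpow_lt_top_of_nonneg hr.le ?_)).ne
    exact ENNReal.mul_ne_top (ENNReal.mul_ne_top hK hf.2.ne) hg.2.ne
  have hjoint : StronglyMeasurable fun z : ℝ × ℝ => integrand α γ f g z.1 z.2 := by
    refine Measurable.stronglyMeasurable ?_
    have h1 : Measurable fun z : ℝ × ℝ => f (z.1 - z.2) :=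
      hfm.measurable.comp (measurable_fst.sub measurable_snd)
    have h2 : Measurable fun z : ℝ × ℝ => g (z.1 - γ z.2) :=
      hgm.measurable.comp (measurable_fst.sub (hγ.comp measurable_snd))
    have h3 : Measurable fun z : ℝ × ℝ => ((z.2 ^ (1 - α) : ℝ) : ℂ) := by fun_prop
    exact (h1.mul h2).div h3
  refine ⟨?_, ?_, ?_⟩
  · filter_upwards [ae_lt_top (hMm.pow_const r) hfin] with x hx
    refine ⟨(hjoint.comp_measurable measurable_prodMk_left).aestronglyMeasurable, ?_⟩
    rw [HasFiniteIntegral, hMint]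
    by_contra h
    rw [not_lt, top_le_iff] at h
    rw [h, ENNReal.top_rpow_of_pos hr] at hx
    exact lt_irrefl _ hx
  · exact (hjoint.integral_prod_right' (ν := volume.restrict (Ioi 0))).aestronglyMeasurable
  · rw [hnorm hr, one_div, ENNReal.rpow_inv_le_iff hr]
    refine (lintegral_mono fun x => ENNReal.rpow_le_rpow ?_ hr.le).trans hbound
    rw [← hMint]
    exact enorm_integral_le_lintegral_enorm _

/-- Passage from the positive form to the bilinear operator. -/
theorem bilinearFractional_bound_of_hasBound {γ : ℝ → ℝ} (hγ : Measurable γ) {α p q r : ℝ}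
    (hp : 0 < p) (hq : 0 < q) (hr : 0 < r) {K : ℝ≥0∞} (hK : K ≠ ∞)
    (hb : HasBound γ (weighted α (Ioi 0)) (1 / p, 1 / q, 1 / r) K) {f g : ℝ → ℂ}
    (hf : MemLp f (ENNReal.ofReal p) volume) (hg : MemLp g (ENNReal.ofReal q) volume) :
    (∀ᵐ x : ℝ, IntegrableOn (integrand α γ f g x) (Ioi 0) volume) ∧
      AEStronglyMeasurable (bilinearFractional α γ f g) volume ∧
      eLpNorm (bilinearFractional α γ f g) (ENNReal.ofReal r) volume ≤
        K * eLpNorm f (ENNReal.ofReal p) volume * eLpNorm g (ENNReal.ofReal q) volume := by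
  obtain ⟨f₀, hf₀, hf'⟩ := hf.1
  obtain ⟨g₀, hg₀, hg'⟩ := hg.1
  obtain ⟨h1, h2, h3⟩ := bilinearFractional_bound_of_stronglyMeasurable hγ hp hq hr hK hb
    hf₀ hg₀ (hf.ae_eq hf') (hg.ae_eq hg')
  have hcongr := ae_integrand_congr hγ α hf' hg'
  have hH : bilinearFractional α γ f g =ᵐ[volume]
      bilinearFractional α γ f₀ g₀ := by
    filter_upwards [hcongr] with x hx using integral_congr_ae hx
  refine ⟨?_, h2.congr hH.symm, ?_⟩
  · filter_upwards [h1, hcongr] with x hx hx' using Integrable.congr hx hx'.symm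
  · rwa [eLpNorm_congr_ae hH, eLpNorm_congr_ae hf', eLpNorm_congr_ae hg']

theorem omega_congr {γ γ₀ : ℝ → ℝ} (h : ∀ t > 0, γ t = γ₀ t) :
    omegaZero₁ γ = omegaZero₁ γ₀ ∧ omegaZero₂ γ = omegaZero₂ γ₀ ∧
      omegaInfty₁ γ = omegaInfty₁ γ₀ := by
  refine ⟨liminf_congr ?_, limsup_congr ?_, liminf_congr ?_⟩
  · filter_upwards [self_mem_nhdsWithin] with t ht using by rw [h t ht]
  · filter_upwards [self_mem_nhdsWithin] with t ht using by rw [h t ht]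
  · filter_upwards [eventually_gt_atTop 0] with t ht using by rw [h t ht]

end BilinearFractional

end

theorem theorem1p2 (α : ℝ) (hα₀ : 0 < α) (hα₁ : α < 1) (γ : ℝ → ℝ)
    (hγ : BilinearFractional.CurveHypothesis γ)
    (hα : BilinearFractional.omegaInfty₁ γ ≤ α / (1 - α))
    (p q r : ℝ) (hpqr : (1 / p, 1 / q, 1 / r) ∈ BilinearFractional.region α γ) :
    ∃ C : ℝ, 0 < C ∧ ∀ f g : ℝ → ℂ,
      MemLp f (ENNReal.ofReal p) volume → MemLp g (ENNReal.ofReal q) volume →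
        (∀ᵐ x : ℝ, IntegrableOn (BilinearFractional.integrand α γ f g x) (Ioi 0) volume) ∧
        MemLp (BilinearFractional.bilinearFractional α γ f g) (ENNReal.ofReal r) volume ∧
        eLpNorm (BilinearFractional.bilinearFractional α γ f g) (ENNReal.ofReal r) volume ≤
          ENNReal.ofReal C * eLpNorm f (ENNReal.ofReal p) volume *
            eLpNorm g (ENNReal.ofReal q) volume := by
  obtain ⟨c, C, hcurve⟩ := hγ.exists_isCurve
  set γ₀ := (Ioi (0 : ℝ)).indicator γ with hγ₀
  have heq : ∀ t > 0, γ t = γ₀ t := fun t ht => (indicator_of_mem (mem_Ioi.2 ht) γ).symm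
  obtain ⟨e₁, e₂, e₃⟩ := BilinearFractional.omega_congr heq
  have hw := hγ.one_lt_omega
  have hwW := hγ.omega_le
  have hregion : BilinearFractional.region α γ = BilinearFractional.region α γ₀ := by
    simp only [BilinearFractional.region, BilinearFractional.commonVertices,
      BilinearFractional.extraVertices, e₂, e₃]
  rw [e₁] at hw
  rw [e₂, e₃] at hwW
  rw [e₃] at hα
  rw [hregion] at hpqr
  obtain ⟨K, hK, hb⟩ := hcurve.exists_hasBound_of_mem_region hα₀ hα₁ hw hwW hα hpqr
  obtain ⟨hp, hq, hr⟩ := BilinearFractional.pos_of_mem_region hα₀ hα₁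
    (hw.trans_le hcurve.omegaZero₁_le) hwW hpqr
  rw [one_div_pos] at hp hq hr
  -- Adding 1 keeps the constant positive even if K = 0.
  refine ⟨K.toReal + 1, by positivity, fun f g hf hg => ?_⟩
  obtain ⟨h1, h2, h3⟩ := BilinearFractional.bilinearFractional_bound_of_hasBound
    hcurve.measurable hp hq hr hK hb hf hg
  have heqOn : ∀ x, EqOn (BilinearFractional.integrand α γ₀ f g x)
      (BilinearFractional.integrand α γ f g x) (Ioi 0) := by
    intro x t ht
    rw [BilinearFractional.integrand, BilinearFractional.integrand, heq t ht]
  have hH : BilinearFractional.bilinearFractional α γ₀ f g =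
      BilinearFractional.bilinearFractional α γ f g :=
    funext fun x => setIntegral_congr_fun measurableSet_Ioi (heqOn x)
  rw [hH] at h2 h3
  have hKC : K ≤ ENNReal.ofReal (K.toReal + 1) := by
    rw [← ENNReal.ofReal_toReal hK]
    exact ENNReal.ofReal_le_ofReal (by simp)
  refine ⟨?_, ⟨h2, h3.trans_lt ?_⟩, h3.trans (by gcongr)⟩
  · filter_upwards [h1] with x hx
    exact hx.congr_fun (heqOn x) measurableSet_Ioi
  · exact ENNReal.mul_lt_top (ENNReal.mul_lt_top hK.lt_top hf.2) hg.2
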